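/- Let $\sigma$ and $\zeta$ be the Weierstrass functions of the hexagonal lattice with periods $\omega_1=\sqrt3$, $\omega_2=\sqrt3e^{\pi i/3}$, let $\eta_1=2\zeta(\omega_1/2)$ and $\rho=e^{2\pi i/3}$. For $0<\alpha<\sqrt3/2$ put $$u(z)=-2\ln|\sigma(z-\alpha)|+\ln|\sigma(z-\rho\alpha)|+\ln|\sigma(z-\bar\rho\alpha)|-\mathrm{Re}(\sqrt3\,\eta_1\alpha z)$$ (the values $u(z),u(\rho z),u(\bar\rho z)$ define the sheets of the Nuttall partition) and $$g(z)=\ln|\sigma(z-\bar\rho\alpha)|-\ln|\sigma(z-\rho\alpha)|-\mathrm{Re}\Bigl(\tfrac{\sqrt3}{3}\eta_1\alpha(\bar\rho-\rho)z\Bigr).$$ Then $g(z)=\frac13\bigl(u(\bar\rho z)-u(\rho z)\bigr)$, so that the zeros of the harmonic function $g$ are the points where $u(\rho z)=u(\bar\rho z)$. Let further $$\pi(z)=-\frac{\sigma(z-z_1)\sigma(z-\rho z_1)\sigma(z-\bar\rho z_1)}{\sigma(z+z_1)\sigma(z+\rho z_1)\sigma(z+\bar\rho z_1)},\qquad z_1=\frac{\sqrt3}3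 ,$$ and let $\Delta$ be the closed triangle with vertices $0,e^{-\pi i/6},e^{\pi i/6}$. For a nondegenerate triangle $\Delta(a_1,a_2,a_3)$ in $\mathbb C$ with vertices numbered clockwise, let $T$ be the Möbius transformation that takes $a_1,a_2,a_3$ to $1,\rho,\bar\rho$. A point $\alpha\in\Delta$ with $\pi(\alpha)=T(\infty)$ is called a parameter of $\Delta(a_1,a_2,a_3)$. We say that a set $J$ of real numbers corresponds to a class $C$ of such triangles if every $\alpha\in J$ is a parameter of some triangle, every triangle in $C$ has exactly one parameter, and, whenever $\alpha$ is a parameter of a triangle, $\alpha\in J$ if and only if the triangle is in $C$. 1) If $0<\alpha<\sqrt3/3$, then $g$ has no critical points on the real axis. This interval corresponds to the isosceles triangles with $|a_1-a_2|=|a_1-a_3|$ whose angle at the apex $a_1$ is less than $\pi/3$. 2) If $\sqrt3/3<\alpha<\sqrt3/2$, then $g$ has exactly two critical points on every half-open interval $[x_0,x_0+\sqrt3)$ of the real axis. This interval of $\alpha$ corresponds to the isosceles triangles with $|a_1-a_2|=|a_1-a_3|$ whose angle at the apex $a_1$ is greater than $\pi/3$. 3) If $\alpha=\sqrt3/3$,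 then $g$ has exactly one critical point on every interval $[x_0,x_0+\sqrt3)$ of the real axis, and each real critical point is double, that is, $g_x-ig_y$ has a zero of order exactly $2$ there. This value corresponds to the equilateral triangles. -/

import Mathlib

open Complex

noncomputable section

namespace Nuttall

/-- The hexagonal lattice, with periods `√3` and `√3 * exp (π i / 3)`. -/
def hexPair : PeriodPair where
  ω₁ := (√3 : ℝ)
  ω₂ := (√3 : ℝ) * exp (Real.pi * I / 3)
  indep := by
    have h3 : (0 : ℝ) < √3 := Real.sqrt_pos.mpr (by norm_num)
    have hs : 0 < Real.sin (Real.pi / 3) := by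
      rw [Real.sin_pi_div_three]; positivity
    have he : exp (Real.pi * I / 3) = (Real.cos (Real.pi / 3) : ℝ) + (Real.sin (Real.pi / 3) : ℝ) * I := by
      rw [show (Real.pi * I / 3 : ℂ) = ((Real.pi / 3 : ℝ) : ℂ) * I by push_cast; ring, exp_mul_I]
      push_cast
      rfl
    rw [LinearIndependent.pair_iff, he]
    generalize Real.cos (Real.pi / 3) = c at *
    generalize Real.sin (Real.pi / 3) = d at *
    intro s t h
    have hi := congrArg Complex.im h
    have hr := congrArg Complex.re h
    simp at hi hr
    have ht : t = 0 := hi.resolve_right hs.ne'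
    subst ht
    simpa using hr

/-- The Weierstrass zeta function
`1 / z + ∑_{ω ≠ 0} (1 / (z - ω) + 1 / ω + z / ω ^ 2)` of the lattice. -/
def zeta (L : PeriodPair) (z : ℂ) : ℂ :=
  1 / z + ∑' l : L.lattice,
    if (l : ℂ) = 0 then 0 else 1 / (z - l) + 1 / (l : ℂ) + z / (l : ℂ) ^ 2

/-- The Weierstrass sigma function
`z * ∏_{ω ≠ 0} (1 - z / ω) * exp (z / ω + z ^ 2 / (2 ω ^ 2))` of the lattice. -/
def sigma (L : PeriodPair) (z : ℂ) : ℂ :=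
  z * ∏' l : L.lattice,
    if (l : ℂ) = 0 then 1 else (1 - z / l) * exp (z / l + z ^ 2 / (2 * (l : ℂ) ^ 2))

/-- The sigma function of the hexagonal lattice. -/
def σ (z : ℂ) : ℂ := sigma hexPair z

/-- The quasi-period `η₁ = 2 ζ(ω₁ / 2)` of the hexagonal lattice. -/
def η₁ : ℂ := 2 * zeta hexPair (hexPair.ω₁ / 2)

/-- The cube root of unity `exp (2 π i / 3)`. -/
def ρ : ℂ := exp (2 * Real.pi * I / 3)

/-- The cube root of unity `exp (-2 π i / 3)`. -/
def ρ' : ℂ := exp (-(2 * Real.pi * I / 3))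

/-- The real part `u` of the abelian integral
`Φ(z) = -2 ln σ(z - α) + ln σ(z - ρ α) + ln σ(z - ρ' α) - √3 η₁ (conj α) z`,
whose values at `z`, `ρ z`, `ρ' z` define the sheets of the Nuttall partition. -/
def u (α z : ℂ) : ℝ :=
  -2 * Real.log ‖σ (z - α)‖ + Real.log ‖σ (z - ρ * α)‖ + Real.log ‖σ (z - ρ' * α)‖
    - ((√3 : ℝ) * η₁ * (starRingEnd ℂ) α * z).re

/-- The harmonic function `g` whose zeros are the solutions of `u (ρ z) = u (ρ' z)`. -/
def g (α z : ℂ) : ℝ :=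
  Real.log ‖σ (z - ρ' * α)‖ - Real.log ‖σ (z - ρ * α)‖
    - (((√3 / 3 : ℝ) : ℂ) * η₁ * (starRingEnd ℂ) α * (ρ' - ρ) * z).re

/-- `z` is a critical point of `f`: `f` is (real) differentiable at `z` and its gradient
vanishes there. -/
def IsCriticalPoint (f : ℂ → ℝ) (z : ℂ) : Prop := HasFDerivAt f (0 : ℂ →L[ℝ] ℝ) z

/-- The multiplicity of a critical point `z` of a function `f` harmonic near `z`: the order of
the zero of the holomorphic function `2 ∂f/∂z = f_x - i f_y` at `z`. -/
def criticalMultiplicity (f : ℂ → ℝ) (z : ℂ) : ℕ∞ :=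
  analyticOrderAt (fun w : ℂ => ((fderiv ℝ f w 1 : ℝ) : ℂ) - I * ((fderiv ℝ f w I : ℝ) : ℂ)) z

/-- The center `√3 / 3` of the triangle with vertices `0`, `exp (-π i / 6)`, `exp (π i / 6)`. -/
def z₁ : ℂ := (√3 / 3 : ℝ)

/-- The function with the periods of the hexagonal lattice which uniformizes the Riemann surface
of `(z ^ 3 - 1) ^ (1 / 3)`. -/
def unif (z : ℂ) : ℂ :=
  -((σ (z - z₁) * σ (z - ρ * z₁) * σ (z - ρ' * z₁)) /
    (σ (z + z₁) * σ (z + ρ * z₁) * σ (z + ρ' * z₁)))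

/-- The closed triangle with vertices `0`, `exp (-π i / 6)`, `exp (π i / 6)`. -/
def fundTriangle : Set ℂ :=
  convexHull ℝ {0, exp (-(Real.pi * I / 6)), exp (Real.pi * I / 6)}

/-- `a₁, a₂, a₃` are the vertices of a nondegenerate triangle, in clockwise order. -/
def IsClockwise (a₁ a₂ a₃ : ℂ) : Prop :=
  ((starRingEnd ℂ) (a₂ - a₁) * (a₃ - a₁)).im < 0

/-- `α` is the parameter of the clockwise triangle `a₁ a₂ a₃`: it lies in `fundTriangle`, and
`unif α = T ∞` for the Möbius transformation `T` that takes `a₁, a₂, a₃` to `1, ρ, ρ'`. -/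
def IsParameter (a₁ a₂ a₃ α : ℂ) : Prop :=
  IsClockwise a₁ a₂ a₃ ∧ α ∈ fundTriangle ∧
    ∃ T : GL (Fin 2) ℂ,
      T • (a₁ : OnePoint ℂ) = ((1 : ℂ) : OnePoint ℂ) ∧
      T • (a₂ : OnePoint ℂ) = (ρ : OnePoint ℂ) ∧
      T • (a₃ : OnePoint ℂ) = (ρ' : OnePoint ℂ) ∧
      T • (OnePoint.infty : OnePoint ℂ) = (unif α : OnePoint ℂ)

/-- The parameters in the set `J` of real numbers correspond exactly to the clockwise triangles
of the class `C`. -/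
def CorrespondsTo (J : Set ℝ) (C : ℂ → ℂ → ℂ → Prop) : Prop :=
  (∀ t ∈ J, ∃ a₁ a₂ a₃ : ℂ, IsParameter a₁ a₂ a₃ t) ∧
  (∀ a₁ a₂ a₃ : ℂ, IsClockwise a₁ a₂ a₃ → C a₁ a₂ a₃ → ∃! α : ℂ, IsParameter a₁ a₂ a₃ α) ∧
  (∀ a₁ a₂ a₃ α : ℂ, IsParameter a₁ a₂ a₃ α →
    ((∃ t ∈ J, α = (t : ℂ)) ↔ C a₁ a₂ a₃))

end Nuttall

end

namespace Nuttall

open Filter Topology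
open scoped PeriodPair

/-! ### Weierstrass zeta and sigma functions of a lattice -/

section General

variable (L : PeriodPair)

/-! Critical points. Put `w = z + α/2` and `s = √3 α / 2`. Locally `g` is the real part of a
holomorphic function whose derivative is `gradFun s w`, that is, `ζ(w + is) - ζ(w - is)` plus a
constant (`hasFDerivAt_g`), so the real critical points are the real zeros of `gradFun s`. On the
real axis `i · gradFun s` is real, even and `√3`-periodic. The addition formula writes `gradFun s w`
as a Möbius function of `℘(w)` (`gradFun_eq`), and `℘` is even of degree two, so `i · gradFun s` is
injective, hence strictly monotone, on `[0, √3/2]`. The zeros are therefore decided by the signs at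
the two ends, which are `2A(s)` and `-2A(3/2 - s)` with `A = axisZeta`.

The symmetries of the lattice give `A(1) = A(3/2) = 0`. Since `A'` is `℘(is)` minus a constant and
`℘` is monotone along the imaginary axis, `A` is strictly convex or strictly concave on `(0, 3/2]`,
so it has opposite signs on `(0, 1)` and `(1, 3/2)` (`axisZeta_sign`). As `s < 3/4`, the end values
have equal signs for `s < 1/2` and opposite signs for `s > 1/2`. For `s = 1/2`, that is `α = √3/3`,
the zero sits at the half-period `√3/2` and is double.

Triangles. The point `x = T(∞)` solves a linear equation in the edge vectors `p`, `q`
(`exists_moebius_iff`). Clockwise orientation gives `|x| < 1`; two equal sides at `a₁` mean that `x`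
is real, and then `x` has the sign of `cos(apex) - 1/2`. On the other side `unif` is a Möbius
function of `℘'` (`unif_eq`), and `℘'` has degree three and is invariant under rotation by `ρ`.
Hence no other point of the fundamental triangle shares its value with a point of the open real
segment (`eq_of_unif_eq`), and `unif` decreases on `[0, √3/2]` from `1` through `0` at `√3/3` to
`-1`.

Both halves rest on the factorizations `sigma_mul_sigma` and `sigma_mul_sigma_mul_sigma`, which
follow from Liouville's theorem in the form `exists_eq_const_mul`. -/

lemma summable_norm_rpow_lattice : Summable fun l : L.lattice => ‖l‖ ^ (-3 : ℝ) :=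
  ZLattice.summable_norm_rpow _ _ (by simp; norm_num)

/-- The lattice part of the zeta function, without the term `1 / z`. -/
noncomputable def zetaExcept (z : ℂ) : ℂ :=
  ∑' l : L.lattice, if (l : ℂ) = 0 then 0 else 1 / (z - l) + 1 / (l : ℂ) + z / (l : ℂ) ^ 2

lemma zeta_eq (z : ℂ) : zeta L z = 1 / z + zetaExcept L z := rfl

/-- The two correction terms cancel the leading orders in `1/l`: the summand equals `s² / (l² (s -
l))`, which is of order `|l|⁻³`. -/
lemma norm_zetaSummand_le {r : ℝ} {s l : ℂ} (hs : ‖s‖ < r) (h : 2 * r ≤ ‖l‖) (hr : 0 < r) :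
    ‖1 / (s - l) + 1 / l + s / l ^ 2‖ ≤ 2 * r ^ 2 * ‖l‖ ^ (-3 : ℝ) := by
  have hl : 0 < ‖l‖ := by linarith
  have hl0 : l ≠ 0 := norm_pos_iff.mp hl
  have hsl : ‖l‖ / 2 ≤ ‖s - l‖ := by
    rw [norm_sub_rev]
    exact .trans (by linarith) (norm_sub_norm_le l s)
  have hsl0 : s - l ≠ 0 := norm_pos_iff.mp (by linarith)
  have e : 1 / (s - l) + 1 / l + s / l ^ 2 = s ^ 2 / (l ^ 2 * (s - l)) := by
    field_simp; ring
  have e3 : ‖l‖ ^ (-3 : ℝ) = 1 / ‖l‖ ^ 3 := by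
    rw [Real.rpow_neg hl.le, one_div]; norm_cast
  rw [e, norm_div, norm_mul, norm_pow, norm_pow, e3]
  calc ‖s‖ ^ 2 / (‖l‖ ^ 2 * ‖s - l‖) ≤ r ^ 2 / (‖l‖ ^ 2 * (‖l‖ / 2)) := by gcongr
    _ = _ := by field_simp

lemma hasSumLocallyUniformly_zetaExcept :
    HasSumLocallyUniformly
      (fun (l : L.lattice) (z : ℂ) =>
        if (l : ℂ) = 0 then 0 else 1 / (z - l) + 1 / (l : ℂ) + z / (l : ℂ) ^ 2)
      (zetaExcept L) := by
  refine L.hasSumLocallyUniformly_aux (u := (2 * · ^ 2 * ‖·‖ ^ (-3 : ℝ))) _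
    (fun _ _ => (summable_norm_rpow_lattice L).mul_left _) fun r hr =>
    Filter.eventually_atTop.mpr ⟨2 * r, ?_⟩
  rintro _ h s hs l rfl
  split_ifs
  · simpa using! show 0 ≤ 2 * r ^ 2 * (‖(l : ℂ)‖ ^ 3)⁻¹ by positivity
  · exact norm_zetaSummand_le hs h hr

lemma hasDerivAt_zetaSummand {l z : ℂ} (hl : l ≠ z) :
    HasDerivAt (fun z => 1 / (z - l) + 1 / l + z / l ^ 2) (-(1 / (z - l) ^ 2 - 1 / l ^ 2)) z := by
  have h0 : z - l ≠ 0 := sub_ne_zero.mpr hl.symm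
  have h1 := ((hasDerivAt_id z).sub_const l).fun_inv h0
  have h2 := (h1.add_const (1 / l)).add ((hasDerivAt_id z).div_const (l ^ 2))
  have e : (fun z => 1 / (z - l) + 1 / l + z / l ^ 2) =
      (fun x => (id x - l)⁻¹ + 1 / l) + fun x => id x / l ^ 2 := by ext w; simp
  rw [e]
  exact h2.congr_deriv (by simp only [id]; ring)

/-- Locally uniform convergence permits termwise differentiation, and the differentiated series is
minus the one for `℘` without its pole at `0`. -/
lemma hasDerivAt_zetaExcept {z : ℂ} (hz : z ∈ ((L.lattice : Set ℂ) \ {0})ᶜ) :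
    HasDerivAt (zetaExcept L) (-(L.weierstrassPExcept 0 z)) z := by
  have hd : ∀ l : L.lattice, ∀ w ∈ ((L.lattice : Set ℂ) \ {0})ᶜ, HasDerivAt (fun z : ℂ =>
      if (l : ℂ) = 0 then 0 else 1 / (z - l) + 1 / (l : ℂ) + z / (l : ℂ) ^ 2)
      (-(if (l : ℂ) = 0 then 0 else (1 / (w - l) ^ 2 - 1 / (l : ℂ) ^ 2))) w := by
    intro l w hw
    split_ifs with h
    · simpa using hasDerivAt_const w (0 : ℂ)
    · exact hasDerivAt_zetaSummand (by rintro rfl; exact hw ⟨l.2, h⟩)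
  have ho := L.isOpen_compl_lattice_sdiff (s := {0})
  have h1 := (hasSumLocallyUniformly_zetaExcept L).tendstoLocallyUniformlyOn
    (s := ((L.lattice : Set ℂ) \ {0})ᶜ)
  have hdf : DifferentiableOn ℂ (zetaExcept L) ((L.lattice : Set ℂ) \ {0})ᶜ :=
    h1.differentiableOn (.of_forall fun s => .fun_sum fun i _ w hw =>
      (hd i w hw).differentiableAt.differentiableWithinAt) ho
  have h2 := h1.deriv (.of_forall fun s => .fun_sum fun i _ w hw =>
      (hd i w hw).differentiableAt.differentiableWithinAt) ho
  have h3 := (L.hasSum_weierstrassPExcept 0 z).neg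
  rw [HasSum, SummationFilter.unconditional_filter] at h3
  have h4 := h2.tendsto_at hz
  have h5 : deriv (zetaExcept L) z = -(L.weierstrassPExcept 0 z) := by
    refine tendsto_nhds_unique h4 (h3.congr fun s => ?_)
    rw [Function.comp_apply, deriv_fun_sum fun i _ => (hd i z hz).differentiableAt]
    exact Finset.sum_congr rfl fun i _ => (hd i z hz).deriv.symm
  exact h5 ▸ (hdf.differentiableAt (ho.mem_nhds hz)).hasDerivAt

lemma isOpen_compl_lattice : IsOpen ((L.lattice : Set ℂ)ᶜ) := L.isClosed_lattice.isOpen_compl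

lemma hasDerivAt_zeta {z : ℂ} (hz : z ∉ L.lattice) :
    HasDerivAt (zeta L) (-(℘[L] z)) z := by
  have hz0 : z ≠ 0 := by rintro rfl; exact hz (zero_mem _)
  have h1 := (hasDerivAt_inv hz0).add
    (hasDerivAt_zetaExcept L (z := z) (fun h => hz h.1))
  have e : zeta L = (fun y => y⁻¹) + zetaExcept L := by ext w; simp [zeta_eq]
  rw [e]
  refine h1.congr_deriv ?_
  have := L.weierstrassPExcept_def 0 z
  simp only [ZeroMemClass.coe_zero] at this
  rw [this]; simp

/-- The difference between a factor of the sigma function and `1`. -/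
noncomputable def sigmaTerm (l : L.lattice) (z : ℂ) : ℂ :=
  (if (l : ℂ) = 0 then 1 else (1 - z / l) * exp (z / l + z ^ 2 / (2 * (l : ℂ) ^ 2))) - 1

lemma sigma_eq (z : ℂ) : sigma L z = z * ∏' l : L.lattice, (1 + sigmaTerm L l z) := by
  simp [sigma, sigmaTerm]

/-- The derivative of the primary factor is `-w² exp(w + w²/2)`; the mean value inequality on the
disc of radius `|w|` turns its quadratic vanishing into a cubic bound. -/
lemma norm_primaryFactor_sub_one_le {w : ℂ} (hw : ‖w‖ ≤ 1) :
    ‖(1 - w) * exp (w + w ^ 2 / 2) - 1‖ ≤ Real.exp 2 * ‖w‖ ^ 3 := by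
  have hd : ∀ x : ℂ, HasDerivAt (fun w : ℂ => (1 - w) * exp (w + w ^ 2 / 2))
      (-x ^ 2 * exp (x + x ^ 2 / 2)) x := fun x => by
    have h1 := ((hasDerivAt_id x).const_sub 1).fun_mul
      (((hasDerivAt_id x).fun_add (((hasDerivAt_id x).fun_pow 2).div_const 2)).cexp)
    exact h1.congr_deriv (by simp only [id]; push_cast; ring)
  have := (convex_closedBall (0 : ℂ) ‖w‖).norm_image_sub_le_of_norm_hasDerivWithin_le
    (f := fun w : ℂ => (1 - w) * exp (w + w ^ 2 / 2)) (C := ‖w‖ ^ 2 * Real.exp 2)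
    (fun x _ => (hd x).hasDerivWithinAt) (fun x hx => ?_) (x := 0) (y := w) (by simp) (by simp)
  · simp only [sub_zero, zero_add, ne_eq, OfNat.ofNat_ne_zero, not_false_eq_true, zero_pow,
      zero_div, exp_zero, mul_one] at this
    exact this.trans_eq (by ring)
  · simp only [Metric.mem_closedBall, dist_zero_right] at hx
    rw [norm_mul, norm_neg, norm_pow]
    gcongr
    refine (norm_exp_le_exp_norm _).trans (Real.exp_le_exp.mpr ?_)
    refine (norm_add_le _ _).trans ?_
    rw [norm_div, norm_pow]
    norm_num
    nlinarith [norm_nonneg x]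

lemma norm_sigmaTerm_le {r : ℝ} (hr : 0 < r) {z : ℂ} (hz : ‖z‖ < r) (l : L.lattice)
    (hl : r ≤ ‖l‖) : ‖sigmaTerm L l z‖ ≤ Real.exp 2 * r ^ 3 * ‖l‖ ^ (-3 : ℝ) := by
  have hl' : 0 < ‖(l : ℂ)‖ := lt_of_lt_of_le hr hl
  have hl0 : (l : ℂ) ≠ 0 := norm_pos_iff.mp hl'
  have e3 : ‖l‖ ^ (-3 : ℝ) = 1 / ‖(l : ℂ)‖ ^ 3 := by
    rw [Real.rpow_neg (norm_nonneg _), one_div]; norm_cast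
  have e : sigmaTerm L l z = (1 - z / l) * exp (z / l + (z / l) ^ 2 / 2) - 1 := by
    rw [sigmaTerm, if_neg hl0]; congr 4; field_simp
  have hle : ‖z / l‖ ≤ 1 := by
    rw [norm_div, div_le_one hl']; exact hz.le.trans hl
  rw [e, e3]
  refine (norm_primaryFactor_sub_one_le hle).trans ?_
  rw [norm_div, div_pow, mul_assoc, mul_one_div]
  gcongr

lemma eventually_norm_sigmaTerm_le {r : ℝ} (hr : 0 < r) :
    ∀ᶠ l : L.lattice in cofinite, ∀ z ∈ Metric.ball (0 : ℂ) r,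
      ‖sigmaTerm L l z‖ ≤ Real.exp 2 * r ^ 3 * ‖l‖ ^ (-3 : ℝ) := by
  refine (isCompact_iff_finite.mp (isCompact_closedBall (0 : L.lattice) r)).subset ?_
  intro l hl
  simp only [Set.mem_compl_iff, Set.mem_ofPred_eq, not_forall] at hl
  obtain ⟨z, hz, h⟩ := hl
  simp only [Metric.mem_closedBall, dist_zero_right]
  contrapose! h
  exact norm_sigmaTerm_le L hr (by simpa using hz) l h.le

lemma differentiable_sigmaTerm (l : L.lattice) : Differentiable ℂ (sigmaTerm L l) := by
  unfold sigmaTerm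
  split_ifs <;> fun_prop

lemma hasProdLocallyUniformlyOn_sigma {r : ℝ} (hr : 0 < r) :
    HasProdLocallyUniformlyOn (fun (l : L.lattice) z => 1 + sigmaTerm L l z)
      (fun z => ∏' l : L.lattice, (1 + sigmaTerm L l z)) (Metric.ball 0 r) :=
  ((summable_norm_rpow_lattice L).mul_left _).hasProdLocallyUniformlyOn_one_add
    Metric.isOpen_ball (eventually_norm_sigmaTerm_le L hr)
    fun l => (differentiable_sigmaTerm L l).continuous.continuousOn

lemma differentiable_tprod_sigma :
    Differentiable ℂ fun z => ∏' l : L.lattice, (1 + sigmaTerm L l z) := by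
  intro z
  have hr : 0 < ‖z‖ + 1 := by positivity
  have h := hasProdLocallyUniformlyOn_iff_tendstoLocallyUniformlyOn.mp
    (hasProdLocallyUniformlyOn_sigma L hr)
  exact (h.differentiableOn (.of_forall fun s => .fun_finsetProd fun i _ =>
      ((differentiable_sigmaTerm L i).const_add 1).differentiableOn)
    Metric.isOpen_ball).differentiableAt (Metric.isOpen_ball.mem_nhds (by simp))

lemma differentiable_sigma : Differentiable ℂ (sigma L) := by
  have : sigma L = fun z => z * ∏' l : L.lattice, (1 + sigmaTerm L l z) := funext (sigma_eq L)
  rw [this]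
  exact differentiable_id.mul (differentiable_tprod_sigma L)

lemma one_add_sigmaTerm_ne_zero {l : L.lattice} {z : ℂ} (hz : z ≠ l ∨ (l : ℂ) = 0) :
    1 + sigmaTerm L l z ≠ 0 := by
  rw [sigmaTerm, add_sub_cancel]
  split_ifs with h
  · exact one_ne_zero
  · refine mul_ne_zero (fun h' => hz.resolve_right h ?_) (exp_ne_zero _)
    rw [sub_eq_zero, eq_div_iff h, one_mul] at h'
    exact h'.symm

lemma tprod_sigma_ne_zero {z : ℂ} (hz : z ∈ ((L.lattice : Set ℂ) \ {0})ᶜ) :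
    ∏' l : L.lattice, (1 + sigmaTerm L l z) ≠ 0 := by
  refine tprod_one_add_ne_zero_of_summable (fun l => one_add_sigmaTerm_ne_zero L ?_) ?_
  · by_contra! h
    exact hz ⟨h.1 ▸ l.2, h.1 ▸ h.2⟩
  · have hr : 0 < ‖z‖ + 1 := by positivity
    refine Summable.of_norm_bounded_eventually
      (g := fun l : L.lattice => Real.exp 2 * (‖z‖ + 1) ^ 3 * ‖l‖ ^ (-3 : ℝ))
      ((summable_norm_rpow_lattice L).mul_left _) ((eventually_norm_sigmaTerm_le L hr).mono fun l h => ?_)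
    simpa using h z (by simp)

lemma sigma_zero : sigma L 0 = 0 := by simp [sigma]

lemma sigma_ne_zero {z : ℂ} (hz : z ∉ L.lattice) : sigma L z ≠ 0 := by
  rw [sigma_eq]
  exact mul_ne_zero (fun h => hz (h ▸ zero_mem _)) (tprod_sigma_ne_zero L fun h => hz h.1)

lemma deriv_sigma_zero : deriv (sigma L) 0 = 1 := by
  have : sigma L = fun z => z * ∏' l : L.lattice, (1 + sigmaTerm L l z) := funext (sigma_eq L)
  rw [this, deriv_fun_mul differentiableAt_fun_id (differentiable_tprod_sigma L 0)]
  simp [sigmaTerm]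

/-- Matches the product for `σ` with the series for `ζ` factor by factor, which yields `σ' = σ ζ` in
`hasDerivAt_sigma`. -/
lemma logDeriv_sigmaTerm {l : L.lattice} {z : ℂ} (hz : z ∉ L.lattice) :
    logDeriv (fun z => 1 + sigmaTerm L l z) z =
      if (l : ℂ) = 0 then 0 else 1 / (z - l) + 1 / (l : ℂ) + z / (l : ℂ) ^ 2 := by
  by_cases h : (l : ℂ) = 0
  · simp [sigmaTerm, h, logDeriv]
  have e : (fun z => 1 + sigmaTerm L l z) =
      fun z : ℂ => (1 - z / l) * exp (z / l + z ^ 2 / (2 * (l : ℂ) ^ 2)) := by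
    ext z; simp [sigmaTerm, h]
  have hzl : z ≠ l := by rintro rfl; exact hz l.2
  have hzl' : z - l ≠ 0 := sub_ne_zero.mpr hzl
  have hne : 1 - z / l ≠ 0 := by
    rw [sub_ne_zero, ne_comm, ne_eq, div_eq_one_iff_eq h]; exact hzl
  have h1 : HasDerivAt (fun z : ℂ => (1 - z / l) * exp (z / l + z ^ 2 / (2 * (l : ℂ) ^ 2)))
      ((-(1 / l)) * exp (z / l + z ^ 2 / (2 * (l : ℂ) ^ 2)) + (1 - z / l) *
        (exp (z / l + z ^ 2 / (2 * (l : ℂ) ^ 2)) * (1 / l + 2 * z / (2 * (l : ℂ) ^ 2)))) z := by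
    have := (((hasDerivAt_id z).div_const (l : ℂ)).const_sub 1).fun_mul
      ((((hasDerivAt_id z).div_const (l : ℂ)).fun_add
        (((hasDerivAt_id z).fun_pow 2).div_const (2 * (l : ℂ) ^ 2))).cexp)
    exact this.congr_deriv (by simp)
  have hne' : (l : ℂ) - z ≠ 0 := sub_ne_zero.mpr hzl.symm
  rw [e, logDeriv_apply, h1.deriv, if_neg h]
  have := exp_ne_zero (z / l + z ^ 2 / (2 * (l : ℂ) ^ 2))
  generalize exp (z / l + z ^ 2 / (2 * (l : ℂ) ^ 2)) = E at *
  rw [show 1 - z / l = ((l : ℂ) - z) / l by field_simp]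
  rw [show z - l = -((l : ℂ) - z) by ring]
  field_simp
  ring

lemma hasDerivAt_sigma {z : ℂ} (hz : z ∉ L.lattice) :
    HasDerivAt (sigma L) (sigma L z * zeta L z) z := by
  have hz0 : z ≠ 0 := by rintro rfl; exact hz (zero_mem _)
  have hr : 0 < ‖z‖ + 1 := by positivity
  have hP := tprod_sigma_ne_zero L (z := z) fun h => hz h.1
  have h1 := logDeriv_tprod_eq_tsum (f := fun (l : L.lattice) z => 1 + sigmaTerm L l z)
    Metric.isOpen_ball (s := Metric.ball 0 (‖z‖ + 1)) (x := z) (by simp)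
    (fun l => one_add_sigmaTerm_ne_zero L (.inl (by rintro rfl; exact hz l.2)))
    (fun l => ((differentiable_sigmaTerm L l).const_add 1).differentiableOn)
    (by
      simp only [logDeriv_sigmaTerm L hz]
      exact ⟨_, (hasSumLocallyUniformly_zetaExcept L).hasSum⟩)
    ⟨_, hasProdLocallyUniformlyOn_sigma L hr⟩ hP
  simp only [logDeriv_sigmaTerm L hz] at h1
  change _ = zetaExcept L z at h1
  rw [logDeriv_apply, div_eq_iff hP] at h1
  have h2 := (hasDerivAt_id z).fun_mul (differentiable_tprod_sigma L z).hasDerivAt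
  have e : sigma L = fun z => z * ∏' l : L.lattice, (1 + sigmaTerm L l z) := funext (sigma_eq L)
  rw [h1] at h2
  rw [e]
  refine h2.congr_deriv ?_
  rw [zeta_eq]
  simp only [id]
  field_simp

lemma sigma_neg (z : ℂ) : sigma L (-z) = -sigma L z := by
  unfold sigma
  rw [neg_mul, ← (Equiv.neg L.lattice).tprod_eq]
  congr! 4 with l
  simp

lemma zeta_neg (z : ℂ) : zeta L (-z) = -zeta L z := by
  unfold zeta
  rw [neg_add, ← tsum_neg, ← (Equiv.neg L.lattice).tsum_eq]
  congr! 1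
  · simp [div_neg]
  · refine tsum_congr fun l => ?_
    by_cases h : (l : ℂ) = 0
    · simp [h]
    · simp only [Equiv.neg_apply, NegMemClass.coe_neg, neg_eq_zero, h, if_false]
      rw [show -z - -(l : ℂ) = -(z - l) by ring]
      simp only [div_neg, even_two.neg_pow, neg_div]
      ring

/-! ### Quasi-periodicity of `ζ` and `σ`, and the zeros of `σ`. -/

lemma isPreconnected_compl_lattice : IsPreconnected ((L.lattice : Set ℂ)ᶜ) := by
  have hc : (L.lattice : Set ℂ).Countable := by
    rw [← Set.countable_coe_iff]
    exact (L.latticeEquivProd.toEquiv.countable_iff).mpr inferInstance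
  exact (hc.isConnected_compl_of_one_lt_rank (by simp)).isPreconnected

/-- The quasi-periods of the zeta function. -/
lemma exists_zeta_add (l : L.lattice) : ∃ η : ℂ, ∀ z ∉ L.lattice, zeta L (z + l) = zeta L z + η := by
  have hm : ∀ z : ℂ, z + l ∈ L.lattice ↔ z ∈ L.lattice := fun z =>
    L.lattice.add_mem_iff_left l.2
  -- The derivatives `-℘(z + l)` and `-℘(z)` cancel, so the difference is constant on the connected
  -- complement of the lattice.
  have hd : ∀ z ∉ L.lattice, HasDerivAt (fun z => zeta L (z + l) - zeta L z) 0 z := by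
    intro z hz
    have h1 := (hasDerivAt_zeta L (mt (hm z).mp hz)).comp_add_const z (l : ℂ)
    have h2 := h1.fun_sub (hasDerivAt_zeta L hz)
    simpa using h2
  obtain ⟨η, h⟩ := (isOpen_compl_lattice L).exists_is_const_of_deriv_eq_zero
    (isPreconnected_compl_lattice L) (fun z hz => (hd z hz).differentiableAt.differentiableWithinAt)
    (fun z hz => (hd z hz).deriv)
  exact ⟨η, fun z hz => by linear_combination h z hz⟩

lemma eventually_punctured_notMem_lattice (z : ℂ) : ∀ᶠ w in 𝓝[≠] z, w ∉ L.lattice := by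
  filter_upwards [mem_nhdsWithin_of_mem_nhds (L.compl_lattice_sdiff_singleton_mem_nhds z),
    self_mem_nhdsWithin] with w h1 h2 h3
  exact h1 ⟨h3, h2⟩

lemma eq_of_eq_off_lattice {f g : ℂ → ℂ} (hf : Continuous f) (hg : Continuous g)
    (h : ∀ z ∉ L.lattice, f z = g z) (z : ℂ) : f z = g z :=
  tendsto_nhds_unique_of_eventuallyEq (hf.continuousAt.mono_left nhdsWithin_le_nhds)
    (hg.continuousAt.mono_left nhdsWithin_le_nhds)
    ((eventually_punctured_notMem_lattice L z).mono h)

/-- The sigma function is quasi-periodic. -/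
lemma exists_sigma_add (l : L.lattice) :
    ∃ η c : ℂ, c ≠ 0 ∧ ∀ z, sigma L (z + l) = c * exp (η * z) * sigma L z := by
  have hm : ∀ z : ℂ, z + l ∈ L.lattice ↔ z ∈ L.lattice := fun z =>
    L.lattice.add_mem_iff_left l.2
  obtain ⟨η, hη⟩ := exists_zeta_add L l
  -- The logarithmic derivative of this quotient is `ζ(z + l) - η - ζ(z) = 0`.
  have hd : ∀ z ∉ L.lattice, HasDerivAt
      (fun z => sigma L (z + l) * exp (-(η * z)) / sigma L z) 0 z := by
    intro z hz
    have h0 := sigma_ne_zero L hz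
    have h1 := (hasDerivAt_sigma L (mt (hm z).mp hz)).comp_add_const z (l : ℂ)
    have h2 := (h1.fun_mul (((hasDerivAt_id z).const_mul η).fun_neg.cexp)).fun_div
      (hasDerivAt_sigma L hz) h0
    refine h2.congr_deriv ?_
    rw [hη z hz, div_eq_zero_iff]
    left
    simp
    ring
  obtain ⟨c, h⟩ := (isOpen_compl_lattice L).exists_is_const_of_deriv_eq_zero
    (isPreconnected_compl_lattice L) (fun z hz => (hd z hz).differentiableAt.differentiableWithinAt)
    (fun z hz => (hd z hz).deriv)
  refine ⟨η, c, ?_, fun z => ?_⟩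
  · have hw := L.ω₁_div_two_notMem_lattice
    rw [← h _ hw]
    exact div_ne_zero (mul_ne_zero (sigma_ne_zero L (mt (hm _).mp hw)) (exp_ne_zero _))
      (sigma_ne_zero L hw)
  · have hc := (differentiable_sigma L).continuous
    -- The quotient is defined only off the lattice; the resulting identity of entire functions
    -- extends to lattice points by continuity.
    refine eq_of_eq_off_lattice L (f := fun z => sigma L (z + l))
      (g := fun z => c * exp (η * z) * sigma L z) (by fun_prop) (by fun_prop) (fun z hz => ?_) z
    have := h z hz
    rw [div_eq_iff (sigma_ne_zero L hz), exp_neg, ← div_eq_mul_inv,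
      div_eq_iff (exp_ne_zero _)] at this
    rw [this]; ring

lemma sigma_eq_zero_iff {z : ℂ} : sigma L z = 0 ↔ z ∈ L.lattice := by
  refine ⟨fun h => by_contra fun hz => sigma_ne_zero L hz h, fun hz => ?_⟩
  obtain ⟨η, c, -, h⟩ := exists_sigma_add L ⟨z, hz⟩
  simpa [sigma_zero] using h 0

/-- Quasi-periodicity transports `σ'(0) = 1` to every lattice point, so all zeros of `σ` are simple.
-/
lemma deriv_sigma_ne_zero {z : ℂ} (hz : z ∈ L.lattice) : deriv (sigma L) z ≠ 0 := by
  obtain ⟨η, c, hc, h⟩ := exists_sigma_add L ⟨z, hz⟩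
  have h1 : HasDerivAt (fun w => sigma L (w + z)) c 0 := by
    have := ((((hasDerivAt_id (0 : ℂ)).const_mul η).cexp).const_mul c).fun_mul
      (differentiable_sigma L 0).hasDerivAt
    simp only [deriv_sigma_zero, sigma_zero] at this
    have e : (fun w => sigma L (w + z)) = fun w => c * exp (η * id w) * sigma L w := funext h
    rw [e]
    exact this.congr_deriv (by simp)
  have h2 := (differentiable_sigma L (0 + z)).hasDerivAt.comp_add_const 0 z
  rw [zero_add] at h2
  rwa [h2.unique h1]

end General

section General

variable (L : PeriodPair)

/-! ### Liouville's theorem for quotients of entire quasi-periodic functions -/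

/-- Two entire functions with the same factors of automorphy are proportional if the zeros of the
first are simple and are zeros of the second. -/
lemma exists_eq_const_mul {f g : ℂ → ℂ} (hf : Differentiable ℂ f) (hg : Differentiable ℂ g)
    (hq : ∀ l : L.lattice, ∃ e : ℂ → ℂ, (∀ z, e z ≠ 0) ∧
      ∀ z, f (z + l) = e z * f z ∧ g (z + l) = e z * g z)
    (hz : ∀ z, f z = 0 → deriv f z ≠ 0 ∧ g z = 0) : ∃ C : ℂ, ∀ z, g z = C * f z := by
  classical
  -- The quotient `g / f` with its removable singularities filled in by l'Hôpital's rule. It is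
  -- entire and doubly periodic, hence bounded, hence constant.
  set q : ℂ → ℂ := fun z => if f z = 0 then deriv g z / deriv f z else g z / f z with hqdef
  have hdq : Differentiable ℂ q := by
    intro z₀
    by_cases h0 : f z₀ = 0
    · obtain ⟨hf', hg0⟩ := hz z₀ h0
      have hdf : Differentiable ℂ (dslope f z₀) := by
        rw [← differentiableOn_univ]
        exact (differentiableOn_dslope univ_mem).mpr hf.differentiableOn
      have hdg : Differentiable ℂ (dslope g z₀) := by
        rw [← differentiableOn_univ]
        exact (differentiableOn_dslope univ_mem).mpr hg.differentiableOn
      have hne : dslope f z₀ z₀ ≠ 0 := by rwa [dslope_same]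
      refine ((hdg z₀).fun_div (hdf z₀) hne).congr_of_eventuallyEq ?_
      filter_upwards [hdf.continuous.continuousAt.eventually_ne hne] with z hfz
      by_cases hzz : z = z₀
      · subst hzz; simp [hqdef, h0]
      · have h1 : f z = (z - z₀) * dslope f z₀ z := by
          simpa [h0] using (sub_smul_dslope f z₀ z).symm
        have h2 : g z = (z - z₀) * dslope g z₀ z := by
          simpa [hg0] using (sub_smul_dslope g z₀ z).symm
        have h3 : z - z₀ ≠ 0 := sub_ne_zero.mpr hzz
        simp only [hqdef]
        rw [if_neg (by rw [h1]; exact mul_ne_zero h3 hfz), h1, h2, mul_div_mul_left _ _ h3]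
    · refine ((hg z₀).fun_div (hf z₀) h0).congr_of_eventuallyEq ?_
      filter_upwards [hf.continuous.continuousAt.eventually_ne h0] with z hfz
      simp [hqdef, hfz]
  have hne : ∀ z₀, ∀ᶠ z in 𝓝[≠] z₀, f z ≠ 0 := by
    intro z₀
    by_cases h0 : f z₀ = 0
    · exact (hf z₀).hasDerivAt.eventually_ne (hz z₀ h0).1
    · exact (hf.continuous.continuousAt.eventually_ne h0).filter_mono nhdsWithin_le_nhds
  have hper : ∀ z, ∀ w ∈ L.lattice, q (z + w) = q z := by
    intro z₀ w hw
    obtain ⟨e, he, h⟩ := hq ⟨w, hw⟩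
    refine tendsto_nhds_unique_of_eventuallyEq (l := 𝓝[≠] z₀) (f := fun z => q (z + w)) (g := q)
      ((hdq.continuous.comp (continuous_add_const w)).continuousAt.mono_left nhdsWithin_le_nhds)
      (hdq.continuous.continuousAt.mono_left nhdsWithin_le_nhds) ?_
    filter_upwards [hne z₀] with z hfz
    obtain ⟨h1, h2⟩ := h z
    simp only at h1 h2
    simp only [hqdef]
    rw [if_neg hfz, if_neg (by rw [h1]; exact mul_ne_zero (he z) hfz), h1, h2,
      mul_div_mul_left _ _ (he z)]
  refine ⟨q 0, fun z => ?_⟩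
  rw [← hdq.apply_eq_apply_of_bounded (IsZLattice.isCompact_range_of_periodic L.lattice _
    hdq.continuous hper).isBounded z 0]
  by_cases h0 : f z = 0
  · simp [h0, (hz z h0).2]
  · simp [hqdef, h0]

/-! ### The addition formulas -/

lemma deriv_sigma {z : ℂ} (hz : z ∉ L.lattice) : deriv (sigma L) z = sigma L z * zeta L z :=
  (hasDerivAt_sigma L hz).deriv

lemma hasDerivAt_deriv_sigma {z : ℂ} (hz : z ∉ L.lattice) :
    HasDerivAt (deriv (sigma L)) (sigma L z * (zeta L z ^ 2 - ℘[L] z)) z := by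
  have h := ((hasDerivAt_sigma L hz).fun_mul (hasDerivAt_zeta L hz)).congr_of_eventuallyEq
    (f₁ := deriv (sigma L)) ?_
  · exact h.congr_deriv (by ring)
  · filter_upwards [(isOpen_compl_lattice L).mem_nhds hz] with w hw using deriv_sigma L hw

lemma hasDerivAt_weierstrassP {z : ℂ} (hz : z ∉ L.lattice) :
    HasDerivAt ℘[L] (L.derivWeierstrassP z) z := by
  rw [← L.deriv_weierstrassP]
  exact (L.analyticOnNhd_weierstrassP z hz).differentiableAt.hasDerivAt

lemma differentiable_deriv_sigma : Differentiable ℂ (deriv (sigma L)) := fun z =>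
  ((differentiable_sigma L).analyticAt z).deriv.differentiableAt

lemma differentiable_deriv_deriv_sigma : Differentiable ℂ (deriv (deriv (sigma L))) := fun z =>
  ((differentiable_deriv_sigma L).analyticAt z).deriv.differentiableAt

/-- The entire function which equals `σ² ℘` off the lattice. -/
noncomputable def sigmaSqP (z : ℂ) : ℂ :=
  deriv (sigma L) z ^ 2 - sigma L z * deriv (deriv (sigma L)) z

lemma differentiable_sigmaSqP : Differentiable ℂ (sigmaSqP L) :=
  ((differentiable_deriv_sigma L).pow 2).sub
    ((differentiable_sigma L).mul (differentiable_deriv_deriv_sigma L))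

lemma sigmaSqP_eq {z : ℂ} (hz : z ∉ L.lattice) : sigmaSqP L z = sigma L z ^ 2 * ℘[L] z := by
  rw [sigmaSqP, (hasDerivAt_deriv_sigma L hz).deriv, deriv_sigma L hz]
  ring

lemma sigmaSqP_zero : sigmaSqP L 0 = 1 := by
  simp [sigmaSqP, sigma_zero, deriv_sigma_zero]

lemma add_mem_lattice_iff (l : L.lattice) (z : ℂ) : z + l ∈ L.lattice ↔ z ∈ L.lattice :=
  L.lattice.add_mem_iff_left l.2

/-- The condition on `2w` keeps the zeros `±w` of the right side distinct modulo the lattice, hence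
simple as `exists_eq_const_mul` requires. The other `w` are reached by continuity in
`sigma_mul_sigma`. -/
lemma sigma_mul_sigma_of_two_mul_notMem {z w : ℂ} (hz : z ∉ L.lattice) (hw : 2 * w ∉ L.lattice) :
    sigma L z ^ 2 * sigma L w ^ 2 * (℘[L] z - ℘[L] w) = -(sigma L (z + w) * sigma L (z - w)) := by
  have hw1 : w ∉ L.lattice := fun h => hw (by rw [two_mul]; exact add_mem h h)
  have hd := differentiable_sigma L
  suffices ∃ C : ℂ, ∀ z, sigmaSqP L z - ℘[L] w * sigma L z ^ 2 =
      C * (sigma L (z + w) * sigma L (z - w)) by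
    obtain ⟨C, hC⟩ := this
    -- The constant is read off at `z = 0`, where `σ² ℘` has the value `1`.
    have h0 : (1 : ℂ) = C * -sigma L w ^ 2 := by
      have := hC 0
      simp only [sigmaSqP_zero, sigma_zero, zero_add, zero_sub, sigma_neg] at this
      linear_combination this
    have h1 := hC z
    simp only [sigmaSqP_eq L hz] at h1
    linear_combination sigma L w ^ 2 * h1 + sigma L (z + w) * sigma L (z - w) * h0
  refine exists_eq_const_mul L (f := fun z => sigma L (z + w) * sigma L (z - w))
    (g := fun z => sigmaSqP L z - ℘[L] w * sigma L z ^ 2) (by fun_prop)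
    ((differentiable_sigmaSqP L).fun_sub (by fun_prop)) ?_ ?_
  · intro l
    obtain ⟨η, c, hc, h⟩ := exists_sigma_add L l
    refine ⟨fun z => c ^ 2 * exp (2 * η * z), fun z => mul_ne_zero (pow_ne_zero _ hc)
      (exp_ne_zero _), fun z => ⟨?_, ?_⟩⟩
    · beta_reduce
      rw [show z + l + w = z + w + l by ring, show z + l - w = z - w + l by ring, h, h,
        show 2 * η * z = η * (z + w) + η * (z - w) by ring, exp_add]
      ring
    · have hc := (differentiable_sigmaSqP L).continuous
      have hc' := hd.continuous
      refine eq_of_eq_off_lattice L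
        (f := fun z => sigmaSqP L (z + l) - ℘[L] w * sigma L (z + l) ^ 2)
        (g := fun z => c ^ 2 * exp (2 * η * z) * (sigmaSqP L z - ℘[L] w * sigma L z ^ 2))
        (by fun_prop) (by fun_prop) (fun z hz => ?_) z
      rw [sigmaSqP_eq L hz, sigmaSqP_eq L (mt (add_mem_lattice_iff L l z).mp hz), h,
        L.weierstrassP_add_coe, show 2 * η * z = η * z + η * z by ring, exp_add]
      ring
  · intro z h0
    have hder : deriv (fun z => sigma L (z + w) * sigma L (z - w)) z =
        deriv (sigma L) (z + w) * sigma L (z - w) + sigma L (z + w) * deriv (sigma L) (z - w) :=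
      (((hd (z + w)).hasDerivAt.comp_add_const z w).fun_mul
        ((hd (z - w)).hasDerivAt.comp_sub_const z w)).deriv
    rw [hder]
    have hdiff : z + w ∈ L.lattice → z - w ∉ L.lattice := fun h1 h2 => hw (by
      have := sub_mem h1 h2
      rwa [show z + w - (z - w) = 2 * w by ring] at this)
    rcases mul_eq_zero.mp h0 with h0 | h0
    · have h1 := (sigma_eq_zero_iff L).mp h0
      have h2 := hdiff h1
      constructor
      · rw [h0, zero_mul, add_zero]
        exact mul_ne_zero (deriv_sigma_ne_zero L h1) (sigma_ne_zero L h2)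
      · have hzn : z ∉ L.lattice := fun h => hw1 (by simpa using sub_mem h1 h)
        have := L.weierstrassP_add_coe (-w) ⟨z + w, h1⟩
        simp only [neg_add_cancel_comm_assoc, L.weierstrassP_neg] at this
        rw [sigmaSqP_eq L hzn, this]
        ring
    · have h1 := (sigma_eq_zero_iff L).mp h0
      have h2 : z + w ∉ L.lattice := fun h => hdiff h h1
      constructor
      · rw [h0, mul_zero, zero_add]
        exact mul_ne_zero (sigma_ne_zero L h2) (deriv_sigma_ne_zero L h1)
      · have hzn : z ∉ L.lattice := fun h => hw1 (by simpa using sub_mem h h1)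
        have := L.weierstrassP_add_coe w ⟨z - w, h1⟩
        simp only [add_sub_cancel] at this
        rw [sigmaSqP_eq L hzn, this]
        ring

lemma sigma_mul_sigma {z w : ℂ} (hz : z ∉ L.lattice) (hw : w ∉ L.lattice) :
    sigma L z ^ 2 * sigma L w ^ 2 * (℘[L] z - ℘[L] w) = -(sigma L (z + w) * sigma L (z - w)) := by
  have hc := (differentiable_sigma L).continuous
  have hp := (hasDerivAt_weierstrassP L hw).continuousAt
  have h1 : ContinuousAt
      (fun w => sigma L z ^ 2 * sigma L w ^ 2 * (℘[L] z - ℘[L] w)) w := by fun_prop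
  have h2 : ContinuousAt (fun w => -(sigma L (z + w) * sigma L (z - w))) w := by fun_prop
  refine tendsto_nhds_unique_of_eventuallyEq (h1.mono_left (nhdsWithin_le_nhds (s := {w}ᶜ)))
    (h2.mono_left nhdsWithin_le_nhds) ?_
  have h3 : Tendsto (fun w : ℂ => 2 * w) (𝓝[≠] w) (𝓝[≠] (2 * w)) := by
    refine tendsto_nhdsWithin_iff.mpr ⟨((by fun_prop : Continuous fun w : ℂ => 2 * w).tendsto
      w).mono_left nhdsWithin_le_nhds, ?_⟩
    filter_upwards [self_mem_nhdsWithin] with x hx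
    simpa using hx
  filter_upwards [h3.eventually (eventually_punctured_notMem_lattice L (2 * w))] with x hx
  exact sigma_mul_sigma_of_two_mul_notMem L hz hx

/-- The factorization of `℘(z) - ℘(w)` shows its zeros directly; no degree count of elliptic
functions is needed. -/
lemma weierstrassP_eq_iff {z w : ℂ} (hz : z ∉ L.lattice) (hw : w ∉ L.lattice) :
    ℘[L] z = ℘[L] w ↔ z + w ∈ L.lattice ∨ z - w ∈ L.lattice := by
  have h := sigma_mul_sigma L hz hw
  have h1 := sigma_ne_zero L hz
  have h2 := sigma_ne_zero L hw
  rw [← sub_eq_zero, ← sigma_eq_zero_iff, ← sigma_eq_zero_iff, ← mul_eq_zero,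
    ← neg_eq_zero (a := _ * _), ← h]
  simp [h1, h2]

/-- The derivative of `℘` in terms of the sigma function. -/
lemma derivWeierstrassP_mul {w : ℂ} (hw : w ∉ L.lattice) :
    L.derivWeierstrassP w * sigma L w ^ 4 = -sigma L (2 * w) := by
  have hd := differentiable_sigma L
  -- Both sides of `sigma_mul_sigma` vanish at `z = w`; comparing their derivatives in `z` there
  -- gives the formula.
  have h1 : HasDerivAt (fun z => sigma L z ^ 2 * sigma L w ^ 2 * (℘[L] z - ℘[L] w))
      (sigma L w ^ 4 * L.derivWeierstrassP w) w := by
    have := (((hd w).hasDerivAt.fun_pow 2).mul_const (sigma L w ^ 2)).fun_mul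
      ((hasDerivAt_weierstrassP L hw).sub_const (℘[L] w))
    exact this.congr_deriv (by ring)
  have h2 : HasDerivAt (fun z => -(sigma L (z + w) * sigma L (z - w))) (-sigma L (2 * w)) w := by
    have := (((hd (w + w)).hasDerivAt.comp_add_const w w).fun_mul
        ((hd (w - w)).hasDerivAt.comp_sub_const w w)).fun_neg
    refine this.congr_deriv ?_
    rw [sub_self, sigma_zero, deriv_sigma_zero, two_mul]
    ring
  have h3 : (fun z => sigma L z ^ 2 * sigma L w ^ 2 * (℘[L] z - ℘[L] w)) =ᶠ[𝓝 w]
      fun z => -(sigma L (z + w) * sigma L (z - w)) := by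
    filter_upwards [(isOpen_compl_lattice L).mem_nhds hw] with z hz
    exact sigma_mul_sigma L hz hw
  rw [mul_comm]
  exact h1.unique (h2.congr_of_eventuallyEq h3)

lemma derivWeierstrassP_eq_zero_iff {w : ℂ} (hw : w ∉ L.lattice) :
    L.derivWeierstrassP w = 0 ↔ 2 * w ∈ L.lattice := by
  have h := derivWeierstrassP_mul L hw
  have h1 := sigma_ne_zero L hw
  rw [← sigma_eq_zero_iff, ← neg_eq_zero (a := sigma L _), ← h]
  simp [h1]

/-- The logarithmic derivative of `sigma_mul_sigma` with respect to `w`, with `z` fixed. -/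
lemma zeta_add_sub_zeta_sub {z w : ℂ} (hz : z ∉ L.lattice) (hw : w ∉ L.lattice)
    (h1 : z + w ∉ L.lattice) (h2 : z - w ∉ L.lattice) :
    zeta L (z + w) - zeta L (z - w) =
      2 * zeta L w - L.derivWeierstrassP w / (℘[L] z - ℘[L] w) := by
  have hP : ℘[L] z - ℘[L] w ≠ 0 := by
    rw [sub_ne_zero, ne_eq, weierstrassP_eq_iff L hz hw]; tauto
  have hsz := sigma_ne_zero L hz
  have hsw := sigma_ne_zero L hw
  have d1 := ((((hasDerivAt_sigma L hw).fun_pow 2).const_mul (sigma L z ^ 2)).fun_mul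
      ((hasDerivAt_weierstrassP L hw).const_sub (℘[L] z)))
  have d2 := (((hasDerivAt_sigma L h1).comp_const_add z w).fun_mul
      ((hasDerivAt_sigma L h2).comp_const_sub z w)).fun_neg
  have h3 : (fun w => sigma L z ^ 2 * sigma L w ^ 2 * (℘[L] z - ℘[L] w)) =ᶠ[𝓝 w]
      fun w => -(sigma L (z + w) * sigma L (z - w)) := by
    filter_upwards [(isOpen_compl_lattice L).mem_nhds hw] with w hw
    exact sigma_mul_sigma L hz hw
  have h4 := d1.unique (d2.congr_of_eventuallyEq h3)
  have h5 := sigma_mul_sigma L hz hw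
  rw [eq_sub_iff_add_eq, ← eq_sub_iff_add_eq', div_eq_iff hP]
  apply mul_left_cancel₀ (mul_ne_zero (pow_ne_zero 2 hsz) (pow_ne_zero 2 hsw))
  push_cast at h4
  linear_combination (-1) * h4 + (zeta L (z + w) - zeta L (z - w)) * h5

end General

/-! ### The hexagonal lattice and its symmetries -/

lemma sqrt_three_sq : √3 * √3 = (3 : ℝ) := Real.mul_self_sqrt (by norm_num)

lemma sqrt_three_pos : (0 : ℝ) < √3 := by positivity

lemma exp_mul_I_eq (t : ℝ) : exp (t * I) = ⟨Real.cos t, Real.sin t⟩ := by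
  apply Complex.ext <;> simp [exp_ofReal_mul_I_re, exp_ofReal_mul_I_im]

lemma rho_eq : ρ = ⟨-1 / 2, √3 / 2⟩ := by
  rw [ρ, show (2 * Real.pi * I / 3 : ℂ) = ((Real.pi - Real.pi / 3 : ℝ) : ℂ) * I by
    push_cast; ring, exp_mul_I_eq, Real.cos_pi_sub, Real.sin_pi_sub, Real.cos_pi_div_three,
    Real.sin_pi_div_three, neg_div]

lemma rho'_eq : ρ' = ⟨-1 / 2, -(√3 / 2)⟩ := by
  rw [ρ', show (-(2 * Real.pi * I / 3) : ℂ) = ((-(Real.pi - Real.pi / 3) : ℝ) : ℂ) * I by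
    push_cast; ring, exp_mul_I_eq, Real.cos_neg, Real.sin_neg, Real.cos_pi_sub, Real.sin_pi_sub,
    Real.cos_pi_div_three, Real.sin_pi_div_three, neg_div]

@[simp] lemma rho_re : ρ.re = -1 / 2 := by rw [rho_eq]
@[simp] lemma rho_im : ρ.im = √3 / 2 := by rw [rho_eq]
@[simp] lemma rho'_re : ρ'.re = -1 / 2 := by rw [rho'_eq]
@[simp] lemma rho'_im : ρ'.im = -(√3 / 2) := by rw [rho'_eq]

lemma rho_mul_rho' : ρ * ρ' = 1 := by
  have := sqrt_three_sq
  apply Complex.ext <;> simp <;> linarith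

lemma one_add_rho_add_rho' : 1 + ρ + ρ' = 0 := by
  apply Complex.ext <;> simp; norm_num

lemma rho_sq : ρ ^ 2 = ρ' := by
  linear_combination ρ * one_add_rho_add_rho' - rho_mul_rho' - one_add_rho_add_rho'

lemma rho'_sq : ρ' ^ 2 = ρ := by
  linear_combination ρ' * one_add_rho_add_rho' - rho_mul_rho' - one_add_rho_add_rho'

lemma rho_ne_zero : ρ ≠ 0 := left_ne_zero_of_mul_eq_one rho_mul_rho'
lemma conj_rho : (starRingEnd ℂ) ρ = ρ' := by
  apply Complex.ext <;> simp

lemma rho'_sub_rho : ρ' - ρ = -((√3 : ℝ) * I) := by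
  apply Complex.ext <;> simp; ring

lemma norm_rho : ‖ρ‖ = 1 := by
  have := sqrt_three_sq
  rw [← sq_eq_sq₀ (norm_nonneg _) zero_le_one, ← Complex.normSq_eq_norm_sq, normSq_apply]
  simp; linarith

lemma norm_rho' : ‖ρ'‖ = 1 := by rw [← conj_rho, norm_conj, norm_rho]

lemma hexPair_ω₁ : hexPair.ω₁ = (√3 : ℝ) := rfl

lemma hexPair_ω₂ : hexPair.ω₂ = ⟨√3 / 2, 3 / 2⟩ := by
  have := sqrt_three_sq
  change ((√3 : ℝ) : ℂ) * exp (Real.pi * I / 3) = _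
  rw [show (Real.pi * I / 3 : ℂ) = ((Real.pi / 3 : ℝ) : ℂ) * I by push_cast; ring,
    exp_mul_I_eq, Real.cos_pi_div_three, Real.sin_pi_div_three]
  apply Complex.ext <;> simp <;> linarith

/-- The hexagonal lattice. -/
noncomputable abbrev Λ : Submodule ℤ ℂ := hexPair.lattice

lemma mem_hex_iff {z : ℂ} : z ∈ Λ ↔ ∃ m n : ℤ, z.re = √3 * (m + n / 2) ∧ z.im = 3 / 2 * n := by
  simp only [PeriodPair.mem_lattice, hexPair_ω₁, hexPair_ω₂, Complex.ext_iff]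
  refine exists₂_congr fun m n => ?_
  simp
  constructor <;> rintro ⟨h1, h2⟩ <;> constructor <;> linarith

lemma rho_mul_mem {z : ℂ} (hz : z ∈ Λ) : ρ * z ∈ Λ := by
  have := sqrt_three_sq
  rw [mem_hex_iff] at hz ⊢
  obtain ⟨m, n, h1, h2⟩ := hz
  refine ⟨-m - n, m, ?_, ?_⟩
  · simp [h1, h2]; ring
  · simp [h1, h2]; linear_combination ((m : ℝ) + n / 2) / 2 * this

lemma rho'_mul_mem {z : ℂ} (hz : z ∈ Λ) : ρ' * z ∈ Λ := by
  rw [← rho_sq, pow_two, mul_assoc]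
  exact rho_mul_mem (rho_mul_mem hz)

lemma conj_mem {z : ℂ} (hz : z ∈ Λ) : (starRingEnd ℂ) z ∈ Λ := by
  rw [mem_hex_iff] at hz ⊢
  obtain ⟨m, n, h1, h2⟩ := hz
  refine ⟨m + n, -n, ?_, ?_⟩ <;> simp [h1, h2]; ring

lemma rho_mul_mem_iff {z : ℂ} : ρ * z ∈ Λ ↔ z ∈ Λ := by
  refine ⟨fun h => ?_, rho_mul_mem⟩
  have := rho'_mul_mem h
  rwa [← mul_assoc, mul_comm ρ', rho_mul_rho', one_mul] at this

lemma rho'_mul_mem_iff {z : ℂ} : ρ' * z ∈ Λ ↔ z ∈ Λ := by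
  refine ⟨fun h => ?_, rho'_mul_mem⟩
  have := rho_mul_mem h
  rwa [← mul_assoc, rho_mul_rho', one_mul] at this

/-- The squared norm is `3 (m² + mn + n²)`, and a nonzero integral value of this positive definite
form is at least `1`. -/
lemma sqrt_three_le_norm {z : ℂ} (hz : z ∈ Λ) (h0 : z ≠ 0) : √3 ≤ ‖z‖ := by
  have h3 := sqrt_three_sq
  obtain ⟨m, n, h1, h2⟩ := mem_hex_iff.mp hz
  have hmn : 1 ≤ m ^ 2 + m * n + n ^ 2 := by
    by_contra! h
    have h' : m ^ 2 + m * n + n ^ 2 ≤ 0 := by linarith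
    have hn : n = 0 := by nlinarith [sq_nonneg (2 * m + n), sq_nonneg n]
    have hm : m = 0 := by subst hn; nlinarith
    subst hn hm
    exact h0 (Complex.ext (by simpa using h1) (by simpa using h2))
  have hmn' : (1 : ℝ) ≤ m ^ 2 + m * n + n ^ 2 := by exact_mod_cast hmn
  rw [← sq_le_sq₀ (by positivity) (norm_nonneg _), ← Complex.normSq_eq_norm_sq, normSq_apply,
    h1, h2]
  nlinarith

/-- Multiplication by `ρ` as a permutation of the hexagonal lattice. -/
noncomputable def rhoEquiv : Λ ≃ Λ where
  toFun l := ⟨ρ * l, rho_mul_mem l.2⟩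
  invFun l := ⟨ρ' * l, rho'_mul_mem l.2⟩
  left_inv l := Subtype.ext (by simp [← mul_assoc, mul_comm ρ' ρ, rho_mul_rho'])
  right_inv l := Subtype.ext (by simp [← mul_assoc, rho_mul_rho'])

/-- Complex conjugation as a permutation of the hexagonal lattice. -/
noncomputable def conjEquiv : Λ ≃ Λ where
  toFun l := ⟨(starRingEnd ℂ) l, conj_mem l.2⟩
  invFun l := ⟨(starRingEnd ℂ) l, conj_mem l.2⟩
  left_inv l := Subtype.ext (by simp)
  right_inv l := Subtype.ext (by simp)

@[simp] lemma rhoEquiv_coe (l : Λ) : (rhoEquiv l : ℂ) = ρ * l := rfl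
@[simp] lemma conjEquiv_coe (l : Λ) : (conjEquiv l : ℂ) = (starRingEnd ℂ) l := rfl

/-! ### Behaviour of `σ`, `ζ`, `℘` and `℘'` under rotation by `ρ` and complex conjugation. -/

lemma sigma_rho_mul (z : ℂ) : sigma hexPair (ρ * z) = ρ * sigma hexPair z := by
  unfold sigma
  rw [← rhoEquiv.tprod_eq, mul_assoc]
  congr 2
  refine tprod_congr fun l => ?_
  have h := rho_ne_zero
  simp only [rhoEquiv_coe, mul_eq_zero, h, false_or]
  rw [mul_div_mul_left _ _ h, mul_pow, mul_pow, mul_left_comm 2, mul_div_mul_left _ _ (by simp [h])]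

lemma sigma_rho'_mul (z : ℂ) : sigma hexPair (ρ' * z) = ρ' * sigma hexPair z := by
  rw [← rho_sq, pow_two, mul_assoc, sigma_rho_mul, sigma_rho_mul, mul_assoc]

lemma zeta_rho_mul (z : ℂ) : zeta hexPair (ρ * z) = ρ' * zeta hexPair z := by
  have hρ := rho_ne_zero
  have hr : ρ' = ρ⁻¹ := eq_inv_of_mul_eq_one_right rho_mul_rho'
  unfold zeta
  rw [← rhoEquiv.tsum_eq, mul_add, ← tsum_mul_left, hr]
  congr! 1
  · simp [mul_comm]
  · refine tsum_congr fun l => ?_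
    by_cases h : (l : ℂ) = 0
    · simp [h]
    · simp only [rhoEquiv_coe, mul_eq_zero, hρ, h, if_false, or_self]
      rw [← mul_sub]
      field_simp

lemma derivWeierstrassP_rho_mul (z : ℂ) :
    hexPair.derivWeierstrassP (ρ * z) = hexPair.derivWeierstrassP z := by
  have h3 : ρ ^ 3 = 1 := by rw [pow_succ, rho_sq, mul_comm, rho_mul_rho']
  unfold PeriodPair.derivWeierstrassP
  rw [← rhoEquiv.tsum_eq]
  congr! 3 with l
  rw [rhoEquiv_coe, ← mul_sub, mul_pow, h3, one_mul]

lemma zeta_conj (z : ℂ) :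
    zeta hexPair ((starRingEnd ℂ) z) = (starRingEnd ℂ) (zeta hexPair z) := by
  unfold zeta
  rw [← conjEquiv.tsum_eq, map_add, conj_tsum]
  congr! 1
  · simp
  · refine tsum_congr fun l => ?_
    by_cases h : (l : ℂ) = 0
    · simp [h]
    · simp [h]

lemma weierstrassP_conj (z : ℂ) :
    ℘[hexPair] ((starRingEnd ℂ) z) = (starRingEnd ℂ) (℘[hexPair] z) := by
  unfold PeriodPair.weierstrassP
  rw [← conjEquiv.tsum_eq, conj_tsum]
  exact tsum_congr fun l => by simp

lemma derivWeierstrassP_conj (z : ℂ) :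
    hexPair.derivWeierstrassP ((starRingEnd ℂ) z) =
      (starRingEnd ℂ) (hexPair.derivWeierstrassP z) := by
  unfold PeriodPair.derivWeierstrassP
  rw [← conjEquiv.tsum_eq, map_neg, conj_tsum]
  congr 1
  exact tsum_congr fun l => by
    rw [map_div₀, map_pow, map_sub, Complex.conj_ofNat, conjEquiv_coe]

/-- Both sides of the difference `u (ρ' z) - u (ρ z)` reduce to sigma functions of
`z - ρ α` and `z - ρ' α`. -/
lemma g_eq_u_sub_u (α : ℝ) (z : ℂ) : g α z = (u α (ρ' * z) - u α (ρ * z)) / 3 := by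
  have hn : ∀ z, ‖σ (ρ * z)‖ = ‖σ z‖ := fun z => by
    rw [σ, sigma_rho_mul, norm_mul, norm_rho, one_mul]; rfl
  have hn' : ∀ z, ‖σ (ρ' * z)‖ = ‖σ z‖ := fun z => by
    rw [σ, sigma_rho'_mul, norm_mul, norm_rho', one_mul]; rfl
  have h1 := rho_mul_rho'
  have h2 := rho_sq
  have h3 := rho'_sq
  have e1 : ‖σ (ρ' * z - α)‖ = ‖σ (z - ρ * α)‖ := by
    rw [← hn' (z - _)]; congr 2; linear_combination (α : ℂ) * h1
  have e2 : ‖σ (ρ' * z - ρ * α)‖ = ‖σ (z - ρ' * α)‖ := by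
    rw [← hn' (z - _)]; congr 2; linear_combination (α : ℂ) * h3
  have e3 : ‖σ (ρ' * z - ρ' * α)‖ = ‖σ (z - α)‖ := by rw [← mul_sub, hn']
  have e4 : ‖σ (ρ * z - α)‖ = ‖σ (z - ρ' * α)‖ := by
    rw [← hn (z - _)]; congr 2; linear_combination (α : ℂ) * h1
  have e5 : ‖σ (ρ * z - ρ' * α)‖ = ‖σ (z - ρ * α)‖ := by
    rw [← hn (z - _)]; congr 2; linear_combination (α : ℂ) * h2
  have e6 : ‖σ (ρ * z - ρ * α)‖ = ‖σ (z - α)‖ := by rw [← mul_sub, hn]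
  have e7 : (((√3 / 3 : ℝ) : ℂ) * η₁ * (starRingEnd ℂ) α * (ρ' - ρ) * z).re =
      (((√3 : ℝ) * η₁ * (starRingEnd ℂ) α * (ρ' * z)).re -
        ((√3 : ℝ) * η₁ * (starRingEnd ℂ) α * (ρ * z)).re) / 3 := by
    rw [← sub_re, div_eq_inv_mul (Complex.re _), ← re_ofReal_mul]
    congr 1; push_cast; ring
  rw [g, u, u, e1, e2, e3, e4, e5, e6, e7]
  ring

/-! ### The function `unif` in terms of `℘'` -/

section General

variable (L : PeriodPair)

/-- The entire function which equals `σ³ ℘'` off the lattice. -/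
noncomputable def sigmaCubeP' (z : ℂ) : ℂ :=
  sigma L z * deriv (sigmaSqP L) z - 2 * deriv (sigma L) z * sigmaSqP L z

lemma differentiable_sigmaCubeP' : Differentiable ℂ (sigmaCubeP' L) := by
  have h1 := differentiable_sigma L
  have h2 := differentiable_deriv_sigma L
  have h3 := differentiable_sigmaSqP L
  have h4 : Differentiable ℂ (deriv (sigmaSqP L)) := fun z =>
    (h3.analyticAt z).deriv.differentiableAt
  unfold sigmaCubeP'
  fun_prop

lemma sigmaCubeP'_eq {z : ℂ} (hz : z ∉ L.lattice) :
    sigmaCubeP' L z = sigma L z ^ 3 * L.derivWeierstrassP z := by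
  have h := (((hasDerivAt_sigma L hz).fun_pow 2).fun_mul
    (hasDerivAt_weierstrassP L hz)).congr_of_eventuallyEq (f₁ := sigmaSqP L) (by
      filter_upwards [(isOpen_compl_lattice L).mem_nhds hz] with w hw using sigmaSqP_eq L hw)
  rw [sigmaCubeP', h.deriv, sigmaSqP_eq L hz, deriv_sigma L hz]
  push_cast
  ring

lemma sigmaCubeP'_zero : sigmaCubeP' L 0 = -2 := by
  simp [sigmaCubeP', sigma_zero, deriv_sigma_zero, sigmaSqP_zero]

end General

lemma sub_rho_mul_notMem {a : ℂ} (ha : a - ρ * a ∉ Λ) : ρ * a - ρ' * a ∉ Λ ∧ ρ' * a - a ∉ Λ := by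
  constructor
  · rwa [show ρ * a - ρ' * a = ρ * (a - ρ * a) by linear_combination a * rho_sq, rho_mul_mem_iff]
  · rwa [show ρ' * a - a = ρ' * (a - ρ * a) by linear_combination a * rho_mul_rho',
      rho'_mul_mem_iff]

/-- The analogue of `sigma_mul_sigma` for `℘'`. Invariance of `℘'` under `ρ` puts its value at `a`
also at `ρa` and `ρ'a`. The relation `1 + ρ + ρ' = 0` matches the automorphy factors, and `a - ρa ∉
Λ` makes the three zeros distinct. -/
lemma sigma_mul_sigma_mul_sigma {a z : ℂ} (ha : a ∉ Λ) (ha' : a - ρ * a ∉ Λ) (hz : z ∉ Λ) :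
    σ z ^ 3 * σ a ^ 3 * (hexPair.derivWeierstrassP z - hexPair.derivWeierstrassP a) =
      2 * (σ (z - a) * σ (z - ρ * a) * σ (z - ρ' * a)) := by
  have hs : σ = sigma hexPair := rfl
  have hd : Differentiable ℂ σ := differentiable_sigma hexPair
  have hr := one_add_rho_add_rho'
  have hrr := rho_mul_rho'
  obtain ⟨ha2, ha3⟩ := sub_rho_mul_notMem ha'
  have hP' : ∀ b, hexPair.derivWeierstrassP (ρ' * b) = hexPair.derivWeierstrassP b := fun b => by
    rw [← derivWeierstrassP_rho_mul, ← mul_assoc, hrr, one_mul]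
  suffices ∃ C : ℂ, ∀ z, sigmaCubeP' hexPair z - hexPair.derivWeierstrassP a * σ z ^ 3 =
      C * (σ (z - a) * σ (z - ρ * a) * σ (z - ρ' * a)) by
    obtain ⟨C, hC⟩ := this
    have h0 := hC 0
    simp only [sigmaCubeP'_zero, hs, sigma_zero, zero_sub, sigma_neg, sigma_rho_mul,
      sigma_rho'_mul] at h0
    have h1 := hC z
    rw [sigmaCubeP'_eq _ hz] at h1
    simp only [hs] at h1 ⊢
    linear_combination sigma hexPair a ^ 3 * h1 + (sigma hexPair (z - a) *
      sigma hexPair (z - ρ * a) * sigma hexPair (z - ρ' * a)) * (h0 - C * sigma hexPair a ^ 3 * hrr)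
  refine exists_eq_const_mul hexPair (f := fun z => σ (z - a) * σ (z - ρ * a) * σ (z - ρ' * a))
    (g := fun z => sigmaCubeP' hexPair z - hexPair.derivWeierstrassP a * σ z ^ 3) (by fun_prop)
    ((differentiable_sigmaCubeP' hexPair).fun_sub (by fun_prop)) ?_ ?_
  · intro l
    obtain ⟨η, c, hc, h⟩ := exists_sigma_add hexPair l
    rw [← hs] at h
    refine ⟨fun z => c ^ 3 * exp (3 * η * z), fun z => mul_ne_zero (pow_ne_zero _ hc)
      (exp_ne_zero _), fun z => ⟨?_, ?_⟩⟩
    · beta_reduce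
      rw [add_sub_right_comm, add_sub_right_comm, add_sub_right_comm, h, h, h,
        show 3 * η * z = η * (z - a) + η * (z - ρ * a) + η * (z - ρ' * a) by
          linear_combination η * a * hr, exp_add, exp_add]
      ring
    · have hc := (differentiable_sigmaCubeP' hexPair).continuous
      have hc' := hd.continuous
      refine eq_of_eq_off_lattice hexPair
        (f := fun z => sigmaCubeP' hexPair (z + l) - hexPair.derivWeierstrassP a * σ (z + l) ^ 3)
        (g := fun z => c ^ 3 * exp (3 * η * z) *
          (sigmaCubeP' hexPair z - hexPair.derivWeierstrassP a * σ z ^ 3))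
        (by fun_prop) (by fun_prop) (fun z hz => ?_) z
      rw [sigmaCubeP'_eq _ hz, sigmaCubeP'_eq _ (mt (add_mem_lattice_iff _ l z).mp hz), ← hs, h,
        hexPair.derivWeierstrassP_add_coe, show 3 * η * z = η * z + η * z + η * z by ring,
        exp_add, exp_add]
      ring
  · intro z h0
    have hder : deriv (fun z => σ (z - a) * σ (z - ρ * a) * σ (z - ρ' * a)) z =
        (deriv σ (z - a) * σ (z - ρ * a) + σ (z - a) * deriv σ (z - ρ * a)) * σ (z - ρ' * a) +
          σ (z - a) * σ (z - ρ * a) * deriv σ (z - ρ' * a) :=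
      ((((hd (z - a)).hasDerivAt.comp_sub_const z a).fun_mul
        ((hd (z - ρ * a)).hasDerivAt.comp_sub_const z _)).fun_mul
        ((hd (z - ρ' * a)).hasDerivAt.comp_sub_const z _)).deriv
    have hP : ∀ b, b ∉ Λ → hexPair.derivWeierstrassP b = hexPair.derivWeierstrassP a →
        z - b ∈ Λ → sigmaCubeP' hexPair z - hexPair.derivWeierstrassP a * σ z ^ 3 = 0 := by
      intro b hb hba h1
      have hzn : z ∉ hexPair.lattice := fun h => hb (by simpa using sub_mem h h1)
      have := hexPair.derivWeierstrassP_add_coe b ⟨z - b, h1⟩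
      simp only [add_sub_cancel] at this
      rw [sigmaCubeP'_eq _ hzn, this, hba, hs]
      ring
    have hne : ∀ b, z - b ∈ Λ → ∀ c, b - c ∉ Λ → σ (z - c) ≠ 0 := by
      intro b hb c hbc h
      refine hbc ?_
      have := sub_mem ((sigma_eq_zero_iff hexPair).mp h) hb
      rwa [sub_sub_sub_cancel_left] at this
    have hsymm : ∀ b c : ℂ, b - c ∉ Λ → c - b ∉ Λ := fun b c h h' => h (by
      simpa using neg_mem h')
    rw [hder]
    rcases mul_eq_zero.mp h0 with h0 | h0
    · rcases mul_eq_zero.mp h0 with h0 | h0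
      · have h1 := (sigma_eq_zero_iff _).mp h0
        refine ⟨?_, hP a ha rfl h1⟩
        rw [h0, zero_mul, zero_mul, zero_mul, add_zero, add_zero]
        exact mul_ne_zero (mul_ne_zero (deriv_sigma_ne_zero _ h1) (hne a h1 _ ha'))
          (hne a h1 _ (hsymm _ _ ha3))
      · have h1 := (sigma_eq_zero_iff _).mp h0
        refine ⟨?_, hP _ (mt rho_mul_mem_iff.mp ha) (derivWeierstrassP_rho_mul a) h1⟩
        rw [h0, mul_zero, mul_zero, zero_mul, zero_add, add_zero]
        exact mul_ne_zero (mul_ne_zero (hne _ h1 _ (hsymm _ _ ha')) (deriv_sigma_ne_zero _ h1))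
          (hne _ h1 _ ha2)
    · have h1 := (sigma_eq_zero_iff _).mp h0
      refine ⟨?_, hP _ (mt rho'_mul_mem_iff.mp ha) (hP' a) h1⟩
      rw [h0, mul_zero, zero_add]
      exact mul_ne_zero (mul_ne_zero (hne _ h1 _ ha3) (hne _ h1 _ (hsymm _ _ ha2)))
        (deriv_sigma_ne_zero _ h1)

lemma sub_mem_of_derivWeierstrassP_eq {a z : ℂ} (ha : a ∉ Λ) (ha' : a - ρ * a ∉ Λ) (hz : z ∉ Λ)
    (h : hexPair.derivWeierstrassP z = hexPair.derivWeierstrassP a) :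
    z - a ∈ Λ ∨ z - ρ * a ∈ Λ ∨ z - ρ' * a ∈ Λ := by
  have := sigma_mul_sigma_mul_sigma ha ha' hz
  rw [h, sub_self, mul_zero, eq_comm, mul_eq_zero, mul_eq_zero, mul_eq_zero] at this
  simpa [σ, sigma_eq_zero_iff, or_assoc] using this

/-! ### The function `unif` on the fundamental triangle -/

/-- The three inequalities are the half-planes bounding the triangle: the sector `|arg| ≤ π/6` and
the vertical edge. -/
lemma fundTriangle_le {α : ℂ} (h : α ∈ fundTriangle) :
    √3 * α.im ≤ α.re ∧ -(√3 * α.im) ≤ α.re ∧ α.re ≤ √3 / 2 := by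
  have h3 := sqrt_three_sq
  have hs := sqrt_three_pos
  have e1 : exp (-(Real.pi * I / 6)) = ⟨√3 / 2, -(1 / 2)⟩ := by
    rw [show (-(Real.pi * I / 6) : ℂ) = ((-(Real.pi / 6) : ℝ) : ℂ) * I by push_cast; ring,
      exp_mul_I_eq, Real.cos_neg, Real.sin_neg, Real.cos_pi_div_six, Real.sin_pi_div_six]
  have e2 : exp (Real.pi * I / 6) = ⟨√3 / 2, 1 / 2⟩ := by
    rw [show (Real.pi * I / 6 : ℂ) = ((Real.pi / 6 : ℝ) : ℂ) * I by push_cast; ring,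
      exp_mul_I_eq, Real.cos_pi_div_six, Real.sin_pi_div_six]
  have hsub : fundTriangle ⊆
      {z : ℂ | √3 * z.im ≤ z.re ∧ -(√3 * z.im) ≤ z.re ∧ z.re ≤ √3 / 2} := by
    refine convexHull_min ?_ ?_
    · rw [e1, e2]
      rintro z (rfl | rfl | rfl)
      · simp; positivity
      · refine ⟨?_, ?_, ?_⟩ <;> simp <;> linarith
      · refine ⟨?_, ?_, ?_⟩ <;> simp <;> linarith
    · rintro x ⟨hx1, hx2, hx3⟩ y ⟨hy1, hy2, hy3⟩ a b ha hb hab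
      refine ⟨?_, ?_, ?_⟩ <;> simp <;> nlinarith
  exact hsub h

lemma ofReal_mem_fundTriangle {t : ℝ} (h0 : 0 ≤ t) (h1 : t ≤ √3 / 2) :
    (t : ℂ) ∈ fundTriangle := by
  have h3 := sqrt_three_sq
  have hs := sqrt_three_pos
  have hc : Convex ℝ fundTriangle := convex_convexHull ℝ _
  have m0 : (0 : ℂ) ∈ fundTriangle := subset_convexHull ℝ _ (by simp)
  have m1 : exp (-(Real.pi * I / 6)) ∈ fundTriangle := subset_convexHull ℝ _ (by simp)
  have m2 : exp (Real.pi * I / 6) ∈ fundTriangle := subset_convexHull ℝ _ (by simp)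
  have e : (2⁻¹ : ℝ) • exp (-(Real.pi * I / 6)) + (2⁻¹ : ℝ) • exp (Real.pi * I / 6) =
      ((√3 / 2 : ℝ) : ℂ) := by
    rw [show (-(Real.pi * I / 6) : ℂ) = ((-(Real.pi / 6) : ℝ) : ℂ) * I by push_cast; ring,
      show (Real.pi * I / 6 : ℂ) = ((Real.pi / 6 : ℝ) : ℂ) * I by push_cast; ring,
      exp_mul_I_eq, exp_mul_I_eq, Real.cos_neg, Real.sin_neg, Real.cos_pi_div_six,
      Real.sin_pi_div_six]
    apply Complex.ext <;> simp; ring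
  have m3 := hc m1 m2 (by norm_num : (0 : ℝ) ≤ 2⁻¹) (by norm_num : (0 : ℝ) ≤ 2⁻¹) (by norm_num)
  rw [e] at m3
  have hk : t / (√3 / 2) ≤ 1 := by rw [div_le_one (by positivity)]; exact h1
  have m4 := hc m0 m3 (sub_nonneg.mpr hk) (by positivity : 0 ≤ t / (√3 / 2)) (by ring)
  convert m4 using 1
  rw [smul_zero, zero_add, real_smul, ← ofReal_mul, div_mul_cancel₀ _ (by positivity)]

/-- Points of the fundamental triangle have no lattice point closer than `0`. -/
lemma norm_le_norm_sub_of_mem {α l : ℂ} (hα : α ∈ fundTriangle) (hl : l ∈ Λ) :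
    ‖α‖ ≤ ‖α - l‖ := by
  have h3 := sqrt_three_sq
  have hs := sqrt_three_pos
  obtain ⟨h1, h2, h4⟩ := fundTriangle_le hα
  obtain ⟨m, n, hm, hn⟩ := mem_hex_iff.mp hl
  -- `A` and `B` are the barycentric coordinates of `α` at `exp(πi/6)` and `exp(-πi/6)`. The claim
  -- amounts to `A (m + n) + B m ≤ m² + mn + n²`, which reduces to the two nonzero vertices.
  set A : ℝ := α.re * √3 / 3 + α.im with hA
  set B : ℝ := α.re * √3 / 3 - α.im with hB
  have hA0 : 0 ≤ A := by
    have : √3 * A = α.re + √3 * α.im := by rw [hA]; linear_combination α.re / 3 * h3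
    exact nonneg_of_mul_nonneg_right (by rw [this]; linarith) hs
  have hB0 : 0 ≤ B := by
    have : √3 * B = α.re - √3 * α.im := by rw [hB]; linear_combination α.re / 3 * h3
    exact nonneg_of_mul_nonneg_right (by rw [this]; linarith) hs
  have hAB : A + B ≤ 1 := by rw [hA, hB]; nlinarith
  -- Since `2 (m² + mn + n²) = m² + n² + (m + n)²`, this bound for `m`, `±n` and `m + n` gives both
  -- vertex inequalities.
  have hk : ∀ k : ℤ, (k : ℝ) ≤ (k : ℝ) ^ 2 := fun k => by exact_mod_cast Int.le_self_sq k
  have k1 := hk m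
  have k2 := hk n
  have k3 := hk (m + n)
  have k4 := hk (-n)
  push_cast at k3 k4
  have hN0 : (0 : ℝ) ≤ m ^ 2 + m * n + n ^ 2 := by nlinarith [sq_nonneg ((m : ℝ) + n)]
  have i1 : A * (m + n) ≤ A * (m ^ 2 + m * n + n ^ 2 : ℝ) :=
    mul_le_mul_of_nonneg_left (by nlinarith) hA0
  have i2 : B * m ≤ B * (m ^ 2 + m * n + n ^ 2 : ℝ) :=
    mul_le_mul_of_nonneg_left (by nlinarith) hB0
  have i3 : (A + B) * (m ^ 2 + m * n + n ^ 2 : ℝ) ≤ 1 * (m ^ 2 + m * n + n ^ 2 : ℝ) :=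
    mul_le_mul_of_nonneg_right hAB hN0
  have e1 : α.re * l.re + α.im * l.im = 3 / 2 * (A * (m + n) + B * m) := by
    rw [hm, hn, hA, hB]; ring
  have e2 : l.re * l.re + l.im * l.im = 3 * (m ^ 2 + m * n + n ^ 2) := by
    rw [hm, hn]; linear_combination ((m : ℝ) + n / 2) ^ 2 * h3
  rw [← sq_le_sq₀ (norm_nonneg _) (norm_nonneg _), ← Complex.normSq_eq_norm_sq,
    ← Complex.normSq_eq_norm_sq, normSq_apply, normSq_apply, sub_re, sub_im]
  nlinarith

/-- The lattice vector `α - εa` has length at most `|α| + a ≤ 2a < √3`, so it vanishes. -/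
lemma eq_mul_of_sub_mem {α ε : ℂ} {a : ℝ} (hα : α ∈ fundTriangle) (hε : ‖ε‖ = 1) (ha : 0 ≤ a)
    (ha' : a < √3 / 2) (h : α - ε * a ∈ Λ) : α = ε * a := by
  by_contra hne
  have h1 := sqrt_three_le_norm h (sub_ne_zero.mpr hne)
  have h2 := norm_le_norm_sub_of_mem hα h
  have h3 : ‖ε * a‖ = a := by rw [norm_mul, hε, one_mul, norm_real, Real.norm_of_nonneg ha]
  rw [sub_sub_cancel, h3] at h2
  have h4 := norm_sub_le α (ε * a)
  rw [h3] at h4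
  linarith

/-- The arguments of `-1`, `-ρ`, `-ρ'` are `π`, `-π/3`, `π/3`, all outside the sector `|arg| ≤ π/6`.
-/
lemma eq_neg_of_mem_fundTriangle {α : ℂ} {a : ℝ} (hα : α ∈ fundTriangle) (ha : 0 < a) :
    α ≠ -1 * a ∧ α ≠ -ρ * a ∧ α ≠ -ρ' * a := by
  have h3 := sqrt_three_sq
  obtain ⟨h1, h2, -⟩ := fundTriangle_le hα
  refine ⟨?_, ?_, ?_⟩ <;> rintro rfl <;> simp at h1 h2 <;> nlinarith

lemma ofReal_notMem {t : ℝ} (h0 : 0 < t) (h1 : t < √3) : (t : ℂ) ∉ Λ := fun h => by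
  have := sqrt_three_le_norm h (by simpa using h0.ne')
  rw [norm_real, Real.norm_of_nonneg h0.le] at this
  linarith

lemma ofReal_sub_rho_notMem {a : ℝ} (h0 : 0 < a) (h1 : a < √3 / 2) : (a : ℂ) - ρ * a ∉ Λ := by
  intro h
  have h3 := sqrt_three_sq
  have hs := sqrt_three_pos
  obtain ⟨m, n, hm, hn⟩ := mem_hex_iff.mp h
  simp at hn
  have hn1 : (-1 : ℝ) < n := by nlinarith
  have hn2 : (n : ℝ) < 0 := by nlinarith
  have : -1 < n := by exact_mod_cast hn1
  have : n < 0 := by exact_mod_cast hn2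
  omega

lemma z₁_lt : √3 / 3 < √3 / 2 := by have := sqrt_three_pos; linarith

lemma z₁_notMem : z₁ ∉ Λ :=
  ofReal_notMem (by positivity) (by have := sqrt_three_pos; linarith)

lemma z₁_sub_rho_notMem : z₁ - ρ * z₁ ∉ Λ := ofReal_sub_rho_notMem (by positivity) z₁_lt

lemma derivWeierstrassP_z₁_ne_zero : hexPair.derivWeierstrassP z₁ ≠ 0 := by
  rw [ne_eq, derivWeierstrassP_eq_zero_iff _ z₁_notMem,
    show 2 * z₁ = ((2 * (√3 / 3) : ℝ) : ℂ) by rw [z₁]; push_cast; ring]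
  exact ofReal_notMem (by positivity) (by have := sqrt_three_pos; linarith)

/-- Numerator and denominator of `unif` share the nonzero factor `σ(z)³ σ(z₁)³ / 2` up to sign.
Cancelling it needs no condition on the denominator, so the formula also holds at the poles, where
both sides are `0` by convention. -/
lemma unif_eq {z : ℂ} (hz : z ∉ Λ) :
    unif z = (hexPair.derivWeierstrassP z - hexPair.derivWeierstrassP z₁) /
      (hexPair.derivWeierstrassP z + hexPair.derivWeierstrassP z₁) := by
  have h1 := sigma_mul_sigma_mul_sigma z₁_notMem z₁_sub_rho_notMem hz
  have h2 := sigma_mul_sigma_mul_sigma z₁_notMem z₁_sub_rho_notMem (z := -z)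
    (by simpa using hz)
  have hn : ∀ w, σ (-w) = -σ w := sigma_neg hexPair
  rw [show -z - z₁ = -(z + z₁) by ring, show -z - ρ * z₁ = -(z + ρ * z₁) by ring,
    show -z - ρ' * z₁ = -(z + ρ' * z₁) by ring, hn, hn, hn, hn, hexPair.derivWeierstrassP_neg] at h2
  have hsz : σ z ≠ 0 := sigma_ne_zero hexPair hz
  have hs1 : σ z₁ ≠ 0 := sigma_ne_zero hexPair z₁_notMem
  have hk : σ z ^ 3 * σ z₁ ^ 3 / 2 ≠ 0 :=
    div_ne_zero (mul_ne_zero (pow_ne_zero _ hsz) (pow_ne_zero _ hs1)) two_ne_zero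
  have e1 : σ (z - z₁) * σ (z - ρ * z₁) * σ (z - ρ' * z₁) = σ z ^ 3 * σ z₁ ^ 3 / 2 *
      (hexPair.derivWeierstrassP z - hexPair.derivWeierstrassP z₁) := by
    linear_combination -h1 / 2
  have e2 : σ (z + z₁) * σ (z + ρ * z₁) * σ (z + ρ' * z₁) = -(σ z ^ 3 * σ z₁ ^ 3 / 2 *
      (hexPair.derivWeierstrassP z + hexPair.derivWeierstrassP z₁)) := by
    linear_combination h2 / 2
  rw [unif, e1, e2, div_neg, neg_neg, mul_div_mul_left _ _ hk]

lemma unif_zero : unif 0 = 1 := by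
  have hn : ∀ w, σ (-w) = -σ w := sigma_neg hexPair
  have hs : ∀ w, w ∉ Λ → σ w ≠ 0 := fun w => sigma_ne_zero hexPair
  have h1 := hs _ z₁_notMem
  have h2 := hs _ (mt rho_mul_mem_iff.mp z₁_notMem)
  have h3 := hs _ (mt rho'_mul_mem_iff.mp z₁_notMem)
  simp only [unif, zero_sub, zero_add, hn]
  generalize σ z₁ = a at *
  generalize σ (ρ * z₁) = b at *
  generalize σ (ρ' * z₁) = c at *
  field_simp

lemma notMem_of_mem_fundTriangle {α : ℂ} (hα : α ∈ fundTriangle) (h0 : α ≠ 0) : α ∉ Λ :=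
  fun h => h0 (by
    simpa using eq_mul_of_sub_mem (a := 0) (ε := 1) hα (by simp) le_rfl (by positivity)
      (by simpa using h))

/-- `unif` is injective on the open real segment of the fundamental triangle, even among all
points of the triangle. -/
lemma eq_of_unif_eq {α : ℂ} {a : ℝ} (hα : α ∈ fundTriangle) (h0 : 0 < a) (h1 : a < √3 / 2)
    (h : unif α = unif a) : α = a := by
  have hs := sqrt_three_pos
  have ha : (a : ℂ) ∉ Λ := ofReal_notMem h0 (by linarith)
  have ha' := ofReal_sub_rho_notMem h0 h1
  have hy := derivWeierstrassP_z₁_ne_zero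
  rw [unif_eq ha] at h
  by_cases hα0 : α = 0
  · rw [hα0, unif_zero] at h
    by_cases hd : hexPair.derivWeierstrassP a + hexPair.derivWeierstrassP z₁ = 0
    · simp [hd] at h
    · rw [eq_div_iff hd] at h
      exact absurd (by linear_combination h / 2) hy
  have hαΛ := notMem_of_mem_fundTriangle hα hα0
  -- The second alternative arises only from division by zero, which makes poles of `unif` look like
  -- zeros. It is excluded below because the triangle contains no point `-ρᵏ a`.
  have key : hexPair.derivWeierstrassP α = hexPair.derivWeierstrassP a ∨
      hexPair.derivWeierstrassP α = -hexPair.derivWeierstrassP a := by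
    rw [unif_eq hαΛ] at h
    generalize hexPair.derivWeierstrassP α = p at *
    generalize hexPair.derivWeierstrassP a = q at *
    generalize hexPair.derivWeierstrassP z₁ = y at *
    by_cases hp : p + y = 0 <;> by_cases hq : q + y = 0
    · left; linear_combination hp - hq
    · rw [hp, div_zero, eq_comm, div_eq_zero_iff] at h
      right; linear_combination hp + h.resolve_right hq
    · rw [hq, div_zero, div_eq_zero_iff] at h
      right; linear_combination hq + h.resolve_right hp
    · rw [div_eq_div_iff hp hq] at h
      left
      apply mul_left_cancel₀ hy
      linear_combination h / 2
  rcases key with key | key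
  · rcases sub_mem_of_derivWeierstrassP_eq ha ha' hαΛ key with h2 | h2 | h2
    · simpa using eq_mul_of_sub_mem (ε := 1) hα (by simp) h0.le h1 (by simpa using h2)
    · have e := eq_mul_of_sub_mem hα norm_rho h0.le h1 h2
      have := fundTriangle_le hα
      rw [e] at this
      simp at this
      linarith
    · have e := eq_mul_of_sub_mem hα norm_rho' h0.le h1 h2
      have := fundTriangle_le hα
      rw [e] at this
      simp at this
      linarith
  · rw [← hexPair.derivWeierstrassP_neg] at key
    obtain ⟨n1, n2, n3⟩ := eq_neg_of_mem_fundTriangle hα h0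
    rcases sub_mem_of_derivWeierstrassP_eq (a := -a) (by simpa using ha)
      (by rwa [show -(a : ℂ) - ρ * -a = -(a - ρ * a) by ring, Submodule.neg_mem_iff])
      hαΛ key with h2 | h2 | h2
    · exact absurd (eq_mul_of_sub_mem hα (by simp) h0.le h1 (by simpa using h2)) n1
    · exact absurd (eq_mul_of_sub_mem hα (by rw [norm_neg, norm_rho]) h0.le h1
        (by simpa using h2)) n2
    · exact absurd (eq_mul_of_sub_mem hα (by rw [norm_neg, norm_rho']) h0.le h1
        (by simpa using h2)) n3

/-! ### Monotonicity of `unif` on the real segment. -/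

lemma derivWeierstrassP_ofReal_conj (t : ℝ) :
    (starRingEnd ℂ) (hexPair.derivWeierstrassP t) = hexPair.derivWeierstrassP t := by
  rw [← derivWeierstrassP_conj, conj_ofReal]

lemma unif_ofReal {t : ℝ} (h0 : 0 ≤ t) (h1 : t ≤ √3 / 2) : ((unif t).re : ℂ) = unif t := by
  have hs := sqrt_three_pos
  rw [← conj_eq_iff_re]
  rcases h0.eq_or_lt with rfl | h0
  · simp [unif_zero]
  · rw [unif_eq (ofReal_notMem h0 (by linarith)), map_div₀, map_sub, map_add, z₁,
      derivWeierstrassP_ofReal_conj, derivWeierstrassP_ofReal_conj]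

lemma continuousOn_unif : ContinuousOn (fun t : ℝ => (unif t).re) (Set.Icc 0 (√3 / 2)) := by
  have hc : Continuous σ := (differentiable_sigma hexPair).continuous
  have hz : (z₁ : ℂ) = ((√3 / 3 : ℝ) : ℂ) := rfl
  refine continuous_re.comp_continuousOn ?_
  unfold unif
  refine (ContinuousOn.div (by fun_prop) (by fun_prop) fun t ht => ?_).neg
  have hα := ofReal_mem_fundTriangle ht.1 ht.2
  obtain ⟨n1, n2, n3⟩ := eq_neg_of_mem_fundTriangle (a := √3 / 3) hα (by positivity)
  have h0 : (0 : ℝ) ≤ √3 / 3 := by positivity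
  refine mul_ne_zero (mul_ne_zero ?_ ?_) ?_ <;> refine sigma_ne_zero hexPair fun h => ?_
  · exact n1 (eq_mul_of_sub_mem hα (by simp) h0 z₁_lt (by simpa [hz] using h))
  · exact n2 (eq_mul_of_sub_mem hα (by rw [norm_neg, norm_rho]) h0 z₁_lt (by simpa [hz] using h))
  · exact n3 (eq_mul_of_sub_mem hα (by rw [norm_neg, norm_rho']) h0 z₁_lt (by simpa [hz] using h))

lemma unif_sqrt_three_div_two : unif ((√3 / 2 : ℝ) : ℂ) = -1 := by
  have hs := sqrt_three_pos
  have h : ((√3 / 2 : ℝ) : ℂ) ∉ Λ := ofReal_notMem (by positivity) (by linarith)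
  have h0 : hexPair.derivWeierstrassP ((√3 / 2 : ℝ) : ℂ) = 0 := by
    rw [derivWeierstrassP_eq_zero_iff _ h, show 2 * ((√3 / 2 : ℝ) : ℂ) = hexPair.ω₁ by
      rw [hexPair_ω₁]; push_cast; ring]
    exact hexPair.ω₁_mem_lattice
  rw [unif_eq h, h0, zero_sub, zero_add, neg_div, div_self derivWeierstrassP_z₁_ne_zero]

lemma unif_z₁ : unif ((√3 / 3 : ℝ) : ℂ) = 0 := by
  change unif z₁ = 0
  rw [unif_eq z₁_notMem, sub_self, zero_div]

/-- A continuous injective real function on an interval is strictly monotone, and the end values `1`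
and `-1` fix the direction. `eq_of_unif_eq` needs one interior point, so pairs of endpoints are
compared by their values. -/
lemma strictAntiOn_unif : StrictAntiOn (fun t : ℝ => (unif t).re) (Set.Icc 0 (√3 / 2)) := by
  have hs := sqrt_three_pos
  have e0 : unif ((0 : ℝ) : ℂ) = 1 := by simpa using unif_zero
  refine continuousOn_unif.strictAntiOn_of_injOn_Icc (by positivity) ?_ ?_
  · simp only [e0, unif_sqrt_three_div_two]
    norm_num
  · have key : ∀ s ∈ Set.Icc 0 (√3 / 2), ∀ t ∈ Set.Ioo 0 (√3 / 2),
        (unif (s : ℝ)).re = (unif (t : ℝ)).re → s = t := by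
      intro s hs t ht h
      have := eq_of_unif_eq (ofReal_mem_fundTriangle hs.1 hs.2) ht.1 ht.2 (by
        rw [← unif_ofReal hs.1 hs.2, ← unif_ofReal ht.1.le ht.2.le, h])
      exact_mod_cast this
    intro s hs t ht h
    by_cases ht' : t ∈ Set.Ioo 0 (√3 / 2)
    · exact key s hs t ht' h
    by_cases hs' : s ∈ Set.Ioo 0 (√3 / 2)
    · exact (key t ht s hs' h.symm).symm
    have hend : ∀ r ∈ Set.Icc 0 (√3 / 2), r ∉ Set.Ioo 0 (√3 / 2) → r = 0 ∨ r = √3 / 2 := by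
      intro r hr hr'
      by_contra! hne
      exact hr' ⟨lt_of_le_of_ne hr.1 hne.1.symm, lt_of_le_of_ne hr.2 hne.2⟩
    rcases hend s hs hs' with rfl | rfl <;> rcases hend t ht ht' with rfl | rfl <;>
      simp only [e0, unif_sqrt_three_div_two] at h ⊢ <;> norm_num at h

lemma unif_re_mem_Ioo {t : ℝ} (h0 : 0 < t) (h1 : t < √3 / 2) :
    (unif t).re ∈ Set.Ioo (-1 : ℝ) 1 := by
  have e0 : unif ((0 : ℝ) : ℂ) = 1 := by simpa using unif_zero
  have m : t ∈ Set.Icc 0 (√3 / 2) := ⟨h0.le, h1.le⟩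
  have i1 := strictAntiOn_unif ⟨le_rfl, h0.le.trans h1.le⟩ m h0
  have i2 := strictAntiOn_unif m ⟨h0.le.trans h1.le, le_rfl⟩ h1
  simp only [e0, unif_sqrt_three_div_two] at i1 i2
  exact ⟨by simpa using i2, by simpa using i1⟩

lemma exists_unif_eq {x : ℝ} (hx : x ∈ Set.Ioo (-1 : ℝ) 1) :
    ∃ t : ℝ, 0 < t ∧ t < √3 / 2 ∧ unif t = x := by
  have e0 : unif ((0 : ℝ) : ℂ) = 1 := by simpa using unif_zero
  have := intermediate_value_Icc' (by positivity : (0 : ℝ) ≤ √3 / 2) continuousOn_unif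
  simp only [e0, unif_sqrt_three_div_two, neg_re, one_re] at this
  obtain ⟨t, ht, h⟩ := this ⟨hx.1.le, hx.2.le⟩
  simp only at h
  refine ⟨t, lt_of_le_of_ne ht.1 ?_, lt_of_le_of_ne ht.2 ?_, ?_⟩
  · rintro rfl
    rw [e0] at h
    exact hx.2.ne (by simpa using h.symm)
  · rintro rfl
    rw [unif_sqrt_three_div_two] at h
    exact hx.1.ne (by simpa using h)
  · rw [← unif_ofReal ht.1 ht.2, h]

lemma unif_re_pos_iff {t : ℝ} (h0 : 0 < t) (h1 : t < √3 / 2) :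
    0 < (unif t).re ↔ t < √3 / 3 := by
  have := strictAntiOn_unif.lt_iff_gt (a := √3 / 3) (b := t) ⟨by positivity, z₁_lt.le⟩
    ⟨h0.le, h1.le⟩
  simpa only [unif_z₁, zero_re] using this

lemma unif_re_neg_iff {t : ℝ} (h0 : 0 < t) (h1 : t < √3 / 2) :
    (unif t).re < 0 ↔ √3 / 3 < t := by
  have := strictAntiOn_unif.lt_iff_gt (b := √3 / 3) (a := t) ⟨h0.le, h1.le⟩
    ⟨by positivity, z₁_lt.le⟩
  simpa only [unif_z₁, zero_re] using this

/-! ### Triangles and their parameters -/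

/-- The equation for the image `x` of `∞` under the Möbius transformation that takes the vertices
of a triangle with edge vectors `p = a₂ - a₁`, `q = a₃ - a₁` to `1, ρ, ρ'`. -/
def ImageOfInfty (p q x : ℂ) : Prop := x * (q + ρ' * p) = p + ρ' * q

/-- Compares the two sides of the equation for `x`: clockwise orientation makes the right side
positive, which forces `|x| < 1`. -/
lemma normSq_sub_of_isClockwise {p q : ℂ} :
    normSq (q + ρ' * p) - normSq (p + ρ' * q) = -(2 * √3) * ((starRingEnd ℂ) p * q).im := by
  have h3 := sqrt_three_sq
  simp only [normSq_apply, add_re, add_im, mul_re, mul_im, rho'_re, rho'_im, conj_re, conj_im]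
  linear_combination (p.re ^ 2 + p.im ^ 2 - q.re ^ 2 - q.im ^ 2) / 4 * h3

lemma ImageOfInfty.norm_lt_one {p q x : ℂ} (h : ImageOfInfty p q x)
    (hc : ((starRingEnd ℂ) p * q).im < 0) : q + ρ' * p ≠ 0 ∧ ‖x‖ < 1 := by
  have hs := sqrt_three_pos
  have h1 := normSq_sub_of_isClockwise (p := p) (q := q)
  have h2 : normSq (p + ρ' * q) < normSq (q + ρ' * p) := by nlinarith
  have h3 : q + ρ' * p ≠ 0 := normSq_pos.mp (lt_of_le_of_lt (normSq_nonneg _) h2)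
  refine ⟨h3, ?_⟩
  have h4 := normSq_pos.mpr h3
  rw [← h, normSq_mul] at h2
  have h5 : normSq x < 1 := by
    by_contra! hx
    nlinarith
  rw [normSq_eq_norm_sq] at h5
  nlinarith [norm_nonneg x]

lemma exists_moebius_iff {a₁ a₂ a₃ x : ℂ} (hc : IsClockwise a₁ a₂ a₃) :
    (∃ T : GL (Fin 2) ℂ,
      T • (a₁ : OnePoint ℂ) = ((1 : ℂ) : OnePoint ℂ) ∧
      T • (a₂ : OnePoint ℂ) = (ρ : OnePoint ℂ) ∧
      T • (a₃ : OnePoint ℂ) = (ρ' : OnePoint ℂ) ∧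
      T • (OnePoint.infty : OnePoint ℂ) = (x : OnePoint ℂ)) ↔
      ImageOfInfty (a₂ - a₁) (a₃ - a₁) x := by
  have hr := one_add_rho_add_rho'
  have hrr := rho_mul_rho'
  constructor
  · rintro ⟨T, h1, h2, h3, h4⟩
    have key : ∀ {a w : ℂ}, T • (a : OnePoint ℂ) = (w : OnePoint ℂ) →
        T 0 0 * a + T 0 1 = w * (T 1 0 * a + T 1 1) := by
      intro a w h
      rw [OnePoint.smul_some_eq_ite] at h
      by_cases c : T 1 0 * a + T 1 1 = 0
      · simp [c] at h
      · rw [if_neg c, OnePoint.coe_eq_coe] at h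
        exact (div_eq_iff c).mp h
    have c4 : T 1 0 ≠ 0 := by
      intro c
      simp [OnePoint.smul_infty_eq_ite, c] at h4
    rw [OnePoint.smul_infty_eq_ite, if_neg c4, OnePoint.coe_eq_coe, div_eq_iff c4] at h4
    replace h1 := key h1
    replace h2 := key h2
    replace h3 := key h3
    rw [h4] at h1 h2 h3
    apply mul_left_cancel₀ c4
    -- The weights `-(1 + ρ')`, `ρ'`, `1` eliminate `T 0 1` because their sum is zero, and `T 1 1`
    -- because `ρ ρ' = 1`.
    linear_combination -(1 + ρ') * h1 + ρ' * h2 + h3 + (T 1 0 * a₂ + T 1 1) * hrr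
  · intro h
    have hx := (h.norm_lt_one hc).2
    have hx1 : 1 - x ≠ 0 := by
      intro h'
      rw [← sub_eq_zero.mp h', norm_one] at hx
      exact lt_irrefl _ hx
    have hxr : ρ - x ≠ 0 := by
      intro h'
      rw [← sub_eq_zero.mp h', norm_rho] at hx
      exact lt_irrefl _ hx
    have hr1 : 1 - ρ ≠ 0 := fun h' => by
      have := congrArg re h'
      simp at this
      norm_num at this
    have ha : a₂ - a₁ ≠ 0 := by
      intro h'
      simp [IsClockwise, h'] at hc
    have hδ : (1 - x) * (ρ - x) * (a₂ - a₁) ≠ 0 := mul_ne_zero (mul_ne_zero hx1 hxr) ha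
    unfold ImageOfInfty at h
    -- The map sought is `T(z) = x + δ / ((1 - ρ) z + D)` with `δ = (1 - x)(ρ - x)(a₂ - a₁)`; `D` is
    -- chosen so that `a₁` and `a₂` go to `1` and `ρ`, and `a₃` then follows from the equation for
    -- `x`.
    set D : ℂ := (ρ - x) * a₂ - (1 - x) * a₁ with hD
    have e1 : (1 - x) * ((1 - ρ) * a₁ + D) = (1 - x) * (ρ - x) * (a₂ - a₁) := by rw [hD]; ring
    have e2 : (ρ - x) * ((1 - ρ) * a₂ + D) = (1 - x) * (ρ - x) * (a₂ - a₁) := by rw [hD]; ring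
    have e3 : (ρ' - x) * ((1 - ρ) * a₃ + D) = (1 - x) * (ρ - x) * (a₂ - a₁) := by
      rw [hD]
      linear_combination (ρ - 1) * h + (1 - x) * (a₂ - a₁) * hrr
    have hdet : (!![x * (1 - ρ), x * D + (1 - x) * (ρ - x) * (a₂ - a₁); 1 - ρ, D]).det ≠ 0 := by
      rw [Matrix.det_fin_two_of, show x * (1 - ρ) * D -
        (x * D + (1 - x) * (ρ - x) * (a₂ - a₁)) * (1 - ρ) =
          -((1 - ρ) * ((1 - x) * (ρ - x) * (a₂ - a₁))) by ring]
      exact neg_ne_zero.mpr (mul_ne_zero hr1 hδ)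
    obtain ⟨T, hT⟩ : ∃ T : GL (Fin 2) ℂ, (T : Matrix (Fin 2) (Fin 2) ℂ) =
        !![x * (1 - ρ), x * D + (1 - x) * (ρ - x) * (a₂ - a₁); 1 - ρ, D] :=
      ⟨Matrix.GeneralLinearGroup.mkOfDetNeZero _ hdet, rfl⟩
    have t00 : T 0 0 = x * (1 - ρ) := congrFun (congrFun hT 0) 0
    have t01 : T 0 1 = x * D + (1 - x) * (ρ - x) * (a₂ - a₁) := congrFun (congrFun hT 0) 1
    have t10 : T 1 0 = 1 - ρ := congrFun (congrFun hT 1) 0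
    have t11 : T 1 1 = D := congrFun (congrFun hT 1) 1
    have key : ∀ a w : ℂ, (w - x) * ((1 - ρ) * a + D) = (1 - x) * (ρ - x) * (a₂ - a₁) →
        T • (a : OnePoint ℂ) = (w : OnePoint ℂ) := by
      intro a w e
      have hne : (1 - ρ) * a + D ≠ 0 := fun h0 => hδ (by rw [← e, h0, mul_zero])
      rw [OnePoint.smul_some_eq_ite, t00, t01, t10, t11, if_neg hne, OnePoint.coe_eq_coe, div_eq_iff hne]
      linear_combination -e
    refine ⟨T, key _ _ e1, key _ _ e2, key _ _ e3, ?_⟩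
    rw [OnePoint.smul_infty_eq_ite, t00, t10, if_neg hr1, mul_div_cancel_right₀ _ hr1]

lemma isParameter_iff {a₁ a₂ a₃ α : ℂ} : IsParameter a₁ a₂ a₃ α ↔
    IsClockwise a₁ a₂ a₃ ∧ α ∈ fundTriangle ∧ ImageOfInfty (a₂ - a₁) (a₃ - a₁) (unif α) :=
  and_congr_right fun hc => and_congr_right fun _ => exists_moebius_iff hc

/-- The real number which is the image of `∞` for an isosceles triangle with edge vectors
`p`, `q` of the same length. -/
noncomputable def isoscelesImage (p q : ℂ) : ℝ :=
  (2 * ((starRingEnd ℂ) p * q).re - normSq p) / normSq (q + ρ' * p)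

lemma imageOfInfty_isoscelesImage {p q : ℂ} (hpq : normSq p = normSq q)
    (hc : ((starRingEnd ℂ) p * q).im < 0) : ImageOfInfty p q (isoscelesImage p q) := by
  have hs := sqrt_three_pos
  have h3 := sqrt_three_sq
  have h1 := normSq_sub_of_isClockwise (p := p) (q := q)
  have h2 : 0 < normSq (q + ρ' * p) := by nlinarith [normSq_nonneg (p + ρ' * q)]
  have h0 : (starRingEnd ℂ) (q + ρ' * p) ≠ 0 := by
    rw [ne_eq, map_eq_zero]; exact normSq_pos.mp h2
  have h4 : ((normSq (q + ρ' * p) : ℝ) : ℂ) ≠ 0 := by exact_mod_cast h2.ne'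
  have key : (p + ρ' * q) * (starRingEnd ℂ) (q + ρ' * p) =
      ((2 * ((starRingEnd ℂ) p * q).re - normSq p : ℝ) : ℂ) := by
    rw [normSq_apply, normSq_apply] at hpq
    rw [normSq_apply]
    apply Complex.ext <;> simp
    · linear_combination hpq / 2 + (p.re * q.re + p.im * q.im) / 4 * h3
    · linear_combination √3 / 2 * hpq + (p.re * q.im - q.re * p.im) / 4 * h3
  unfold ImageOfInfty
  apply mul_right_cancel₀ h0
  rw [key, mul_assoc, mul_conj, isoscelesImage, ofReal_div, div_mul_cancel₀ _ h4]

/-- The equation reads `p (1 - ρ'x) = q (x - ρ')`, and for real `x` both factors have squared norm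
`1 + x + x²`. -/
lemma ImageOfInfty.normSq_eq {p q : ℂ} {x : ℝ} (h : ImageOfInfty p q x) :
    normSq p = normSq q := by
  have h3 := sqrt_three_sq
  have h1 : p * (1 - ρ' * x) = q * (x - ρ') := by
    unfold ImageOfInfty at h; linear_combination -h
  have e1 : normSq (1 - ρ' * x) = 1 + x + x ^ 2 := by
    simp [normSq_apply]; linear_combination x ^ 2 / 4 * h3
  have e2 : normSq (x - ρ') = 1 + x + x ^ 2 := by
    simp [normSq_apply]; linear_combination h3 / 4
  have h2 := congrArg normSq h1
  rw [normSq_mul, normSq_mul, e1, e2] at h2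
  exact mul_right_cancel₀ (by nlinarith [sq_nonneg (x + 1)]) h2

lemma ImageOfInfty.unique {p q x y : ℂ} (hx : ImageOfInfty p q x) (hy : ImageOfInfty p q y)
    (hc : ((starRingEnd ℂ) p * q).im < 0) : x = y :=
  mul_right_cancel₀ (hx.norm_lt_one hc).1 (Eq.trans hx hy.symm)

lemma exists_parameter_eq {a₁ a₂ a₃ : ℂ} (hc : IsClockwise a₁ a₂ a₃)
    (h : normSq (a₂ - a₁) = normSq (a₃ - a₁)) :
    ∃ t : ℝ, 0 < t ∧ t < √3 / 2 ∧ unif t = isoscelesImage (a₂ - a₁) (a₃ - a₁) ∧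
      ∀ α : ℂ, IsParameter a₁ a₂ a₃ α ↔ α = t := by
  have h1 := imageOfInfty_isoscelesImage h hc
  have h2 := (h1.norm_lt_one hc).2
  rw [norm_real, Real.norm_eq_abs, abs_lt] at h2
  obtain ⟨t, h0, ht, hu⟩ := exists_unif_eq h2
  refine ⟨t, h0, ht, hu, fun α => ⟨fun hα => ?_, ?_⟩⟩
  · obtain ⟨-, hα, hi⟩ := isParameter_iff.mp hα
    exact eq_of_unif_eq hα h0 ht (hu ▸ hi.unique h1 hc)
  · rintro rfl
    exact isParameter_iff.mpr ⟨hc, ofReal_mem_fundTriangle h0.le ht.le, hu ▸ h1⟩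

lemma exists_isParameter {t : ℝ} (h0 : 0 < t) (h1 : t < √3 / 2) :
    ∃ a₁ a₂ a₃ : ℂ, IsParameter a₁ a₂ a₃ t := by
  have hs := sqrt_three_pos
  obtain ⟨i1, i2⟩ := unif_re_mem_Ioo h0 h1
  have hu := unif_ofReal h0.le h1.le
  set x := (unif t).re
  -- These edge vectors solve `p (1 - ρ'x) = q (x - ρ')` identically, and they are clockwise exactly
  -- because `x² < 1`.
  refine ⟨0, x - ρ', 1 - ρ' * x,
    isParameter_iff.mpr ⟨?_, ofReal_mem_fundTriangle h0.le h1.le, ?_⟩⟩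
  · simp only [IsClockwise, sub_zero]
    simp
    nlinarith [mul_pos (sub_pos.mpr i2) (sub_pos.mpr i1)]
  · rw [← hu, ImageOfInfty]
    ring

/-- Reduces each of the three correspondences to a sign condition `P` on the real number `x = unif
t`. -/
lemma correspondsTo_of {J : Set ℝ} {C : ℂ → ℂ → ℂ → Prop} (P : ℝ → Prop)
    (hJ : ∀ t ∈ J, 0 < t ∧ t < √3 / 2)
    (hJP : ∀ t : ℝ, 0 < t → t < √3 / 2 → (t ∈ J ↔ P (unif t).re))
    (hC : ∀ a₁ a₂ a₃ : ℂ, IsClockwise a₁ a₂ a₃ → (C a₁ a₂ a₃ ↔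
      normSq (a₂ - a₁) = normSq (a₃ - a₁) ∧ P (isoscelesImage (a₂ - a₁) (a₃ - a₁)))) :
    CorrespondsTo J C := by
  refine ⟨fun t ht => exists_isParameter (hJ t ht).1 (hJ t ht).2, fun a₁ a₂ a₃ hc h => ?_,
    fun a₁ a₂ a₃ α hα => ?_⟩
  · obtain ⟨t, -, -, -, h⟩ := exists_parameter_eq hc ((hC _ _ _ hc).mp h).1
    exact ⟨t, (h t).mpr rfl, fun α hα => (h α).mp hα⟩
  · obtain ⟨hc, -, hi⟩ := isParameter_iff.mp hα
    rw [hC _ _ _ hc]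
    constructor
    · rintro ⟨t, ht, rfl⟩
      obtain ⟨h0, h1⟩ := hJ t ht
      rw [← unif_ofReal h0.le h1.le] at hi
      have hn := hi.normSq_eq
      have := hi.unique (imageOfInfty_isoscelesImage hn hc) hc
      refine ⟨hn, ?_⟩
      rw [← ofReal_inj.mp this]
      exact (hJP t h0 h1).mp ht
    · rintro ⟨hn, hP⟩
      obtain ⟨t, h0, h1, hu, h⟩ := exists_parameter_eq hc hn
      refine ⟨t, (hJP t h0 h1).mpr ?_, (h α).mp hα⟩
      rw [hu, ofReal_re]
      exact hP

/-! ### Isosceles triangles -/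

lemma dist_eq_dist_iff_normSq {a b c d : ℂ} :
    dist a b = dist c d ↔ normSq (b - a) = normSq (d - c) := by
  rw [dist_comm a, dist_comm c, dist_eq_norm, dist_eq_norm, normSq_eq_norm_sq, normSq_eq_norm_sq,
    sq_eq_sq₀ (norm_nonneg _) (norm_nonneg _)]

lemma normSq_add_pos {p q : ℂ} (hc : ((starRingEnd ℂ) p * q).im < 0) :
    0 < normSq (q + ρ' * p) := by
  have := normSq_sub_of_isClockwise (p := p) (q := q)
  nlinarith [normSq_nonneg (p + ρ' * q), sqrt_three_pos]

lemma cos_angle_eq {a₁ a₂ a₃ : ℂ} (h : normSq (a₂ - a₁) = normSq (a₃ - a₁)) :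
    Real.cos (EuclideanGeometry.angle a₂ a₁ a₃) =
      ((starRingEnd ℂ) (a₂ - a₁) * (a₃ - a₁)).re / normSq (a₂ - a₁) := by
  have hn : ‖a₃ - a₁‖ = ‖a₂ - a₁‖ := by
    rw [normSq_eq_norm_sq, normSq_eq_norm_sq, sq_eq_sq₀ (norm_nonneg _) (norm_nonneg _)] at h
    exact h.symm
  rw [EuclideanGeometry.angle, InnerProductGeometry.cos_angle, vsub_eq_sub, vsub_eq_sub, hn,
    normSq_eq_norm_sq, sq, Complex.inner, mul_comm (a₃ - a₁)]

lemma pi_div_three_mem_Icc : Real.pi / 3 ∈ Set.Icc 0 Real.pi := by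
  constructor <;> linarith [Real.pi_pos]

lemma angle_mem_Icc (a b c : ℂ) : EuclideanGeometry.angle a b c ∈ Set.Icc 0 Real.pi :=
  ⟨EuclideanGeometry.angle_nonneg _ _ _, EuclideanGeometry.angle_le_pi _ _ _⟩

lemma normSq_pos_of_isClockwise {p q : ℂ} (hc : ((starRingEnd ℂ) p * q).im < 0) :
    0 < normSq p := normSq_pos.mpr (by rintro rfl; simp at hc)

/-- The numerator of `isoscelesImage` is `2|p|² (cos(apex) - 1/2)` and its denominator is positive.
-/
lemma angle_lt_iff {a₁ a₂ a₃ : ℂ} (hc : IsClockwise a₁ a₂ a₃)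
    (h : normSq (a₂ - a₁) = normSq (a₃ - a₁)) :
    EuclideanGeometry.angle a₂ a₁ a₃ < Real.pi / 3 ↔
      0 < isoscelesImage (a₂ - a₁) (a₃ - a₁) := by
  have hp := normSq_pos_of_isClockwise hc
  rw [← Real.strictAntiOn_cos.lt_iff_gt pi_div_three_mem_Icc (angle_mem_Icc _ _ _),
    cos_angle_eq h, Real.cos_pi_div_three, lt_div_iff₀ hp, isoscelesImage,
    div_pos_iff_of_pos_right (normSq_add_pos hc)]
  constructor <;> intro <;> linarith

lemma lt_angle_iff {a₁ a₂ a₃ : ℂ} (hc : IsClockwise a₁ a₂ a₃)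
    (h : normSq (a₂ - a₁) = normSq (a₃ - a₁)) :
    Real.pi / 3 < EuclideanGeometry.angle a₂ a₁ a₃ ↔
      isoscelesImage (a₂ - a₁) (a₃ - a₁) < 0 := by
  have hp := normSq_pos_of_isClockwise hc
  rw [← Real.strictAntiOn_cos.lt_iff_gt (angle_mem_Icc _ _ _) pi_div_three_mem_Icc,
    cos_angle_eq h, Real.cos_pi_div_three, div_lt_iff₀ hp, isoscelesImage,
    div_lt_iff₀ (normSq_add_pos hc)]
  constructor <;> intro <;> linarith

lemma normSq_sub_eq_iff {p q : ℂ} (hc : ((starRingEnd ℂ) p * q).im < 0)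
    (h : normSq p = normSq q) : normSq p = normSq (q - p) ↔ isoscelesImage p q = 0 := by
  rw [isoscelesImage, div_eq_zero_iff, or_iff_left (normSq_add_pos hc).ne']
  simp only [normSq_apply, sub_re, sub_im, mul_re, conj_re, conj_im] at *
  constructor <;> intro h' <;> linarith

lemma correspondsTo_lt :
    CorrespondsTo {α | 0 < α ∧ α < √3 / 3} (fun a₁ a₂ a₃ => dist a₁ a₂ = dist a₁ a₃ ∧
      EuclideanGeometry.angle a₂ a₁ a₃ < Real.pi / 3) := by
  refine correspondsTo_of (fun x => 0 < x) (fun t ht => ⟨ht.1, ht.2.trans z₁_lt⟩)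
    (fun t h0 h1 => ?_) (fun a₁ a₂ a₃ hc => ?_)
  · rw [unif_re_pos_iff h0 h1]; exact and_iff_right h0
  · rw [dist_eq_dist_iff_normSq]
    exact and_congr_right fun h => angle_lt_iff hc h

lemma correspondsTo_gt :
    CorrespondsTo {α | √3 / 3 < α ∧ α < √3 / 2} (fun a₁ a₂ a₃ => dist a₁ a₂ = dist a₁ a₃ ∧
      Real.pi / 3 < EuclideanGeometry.angle a₂ a₁ a₃) := by
  have hs := sqrt_three_pos
  refine correspondsTo_of (fun x => x < 0) (fun t ht => ⟨(by positivity : 0 < √3 / 3).trans ht.1,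
    ht.2⟩) (fun t h0 h1 => ?_) (fun a₁ a₂ a₃ hc => ?_)
  · rw [unif_re_neg_iff h0 h1]; exact and_iff_left h1
  · rw [dist_eq_dist_iff_normSq]
    exact and_congr_right fun h => lt_angle_iff hc h

lemma correspondsTo_eq :
    CorrespondsTo {α | α = √3 / 3} (fun a₁ a₂ a₃ => dist a₁ a₂ = dist a₁ a₃ ∧
      dist a₁ a₂ = dist a₂ a₃) := by
  have hs := sqrt_three_pos
  refine correspondsTo_of (fun x => x = 0) ?_ (fun t h0 h1 => ?_) (fun a₁ a₂ a₃ hc => ?_)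
  · rintro t rfl
    exact ⟨by positivity, z₁_lt⟩
  · have i1 := unif_re_pos_iff h0 h1
    have i2 := unif_re_neg_iff h0 h1
    rw [Set.mem_ofPred_eq]
    constructor
    · rintro rfl
      rw [unif_z₁, zero_re]
    · intro h
      rw [h] at i1 i2
      exact le_antisymm (not_lt.mp (fun h' => lt_irrefl _ (i2.mpr h')))
        (not_lt.mp (fun h' => lt_irrefl _ (i1.mpr h')))
  · rw [dist_eq_dist_iff_normSq, dist_eq_dist_iff_normSq]
    refine and_congr_right fun h => ?_
    rw [← normSq_sub_eq_iff hc h, sub_sub_sub_cancel_right]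

/-! ### Quasi-periods of the zeta function of the hexagonal lattice -/

lemma notMem_of_im {z : ℂ} (h0 : 0 < z.im) (h1 : z.im < 3 / 2) : z ∉ Λ := fun h => by
  obtain ⟨m, n, -, hn⟩ := mem_hex_iff.mp h
  have i1 : (0 : ℝ) < n := by linarith
  have i2 : (n : ℝ) < 1 := by linarith
  have : 0 < n := by exact_mod_cast i1
  have : n < 1 := by exact_mod_cast i2
  omega

lemma I_mul_notMem {s : ℝ} (h0 : 0 < s) (h1 : s < 3) : I * s ∉ Λ := fun h => by
  obtain ⟨m, n, hm, hn⟩ := mem_hex_iff.mp h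
  have hs := sqrt_three_pos
  simp at hm hn
  have hm' : (n : ℝ) = -2 * m := by linarith
  have i1 : (-1 : ℝ) < m := by linarith
  have i2 : (m : ℝ) < 0 := by linarith
  have : -1 < m := by exact_mod_cast i1
  have : m < 0 := by exact_mod_cast i2
  omega

lemma add_I_mul_notMem {s : ℝ} (h0 : 0 < s) (h1 : s < 3 / 2) (w : ℝ) :
    (w : ℂ) + I * s ∉ Λ ∧ (w : ℂ) - I * s ∉ Λ := by
  refine ⟨notMem_of_im (by simpa) (by simpa), fun h => ?_⟩
  rw [← neg_mem_iff] at h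
  exact notMem_of_im (z := -((w : ℂ) - I * s)) (by simpa) (by simpa) h

lemma zeta_add_sqrt_three {z : ℂ} (hz : z ∉ Λ) :
    zeta hexPair (z + (√3 : ℝ)) = zeta hexPair z + η₁ := by
  obtain ⟨η, h⟩ := exists_zeta_add hexPair ⟨_, hexPair.ω₁_mem_lattice⟩
  have h1 := h (-(hexPair.ω₁ / 2)) (by
    rw [neg_mem_iff]; exact hexPair.ω₁_div_two_notMem_lattice)
  rw [zeta_neg, show -(hexPair.ω₁ / 2) + hexPair.ω₁ = hexPair.ω₁ / 2 by ring] at h1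
  have h2 : η = η₁ := by rw [η₁]; linear_combination -h1
  rw [← h2]
  exact h z hz

lemma zeta_add_rho_mul {z : ℂ} (hz : z ∉ Λ) :
    zeta hexPair (z + ρ * (√3 : ℝ)) = zeta hexPair z + ρ' * η₁ := by
  have hz' := mt rho'_mul_mem_iff.mp hz
  have e : z + ρ * (√3 : ℝ) = ρ * (ρ' * z + (√3 : ℝ)) := by linear_combination -z * rho_mul_rho'
  rw [e, zeta_rho_mul, zeta_add_sqrt_three hz', mul_add, ← zeta_rho_mul, ← mul_assoc,
    rho_mul_rho', one_mul]

lemma zeta_add_rho'_mul {z : ℂ} (hz : z ∉ Λ) :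
    zeta hexPair (z + ρ' * (√3 : ℝ)) = zeta hexPair z + ρ * η₁ := by
  have hz' := mt rho'_mul_mem_iff.mp hz
  have e : z + ρ' * (√3 : ℝ) = ρ * (ρ' * z + ρ * (√3 : ℝ)) := by
    linear_combination -z * rho_mul_rho' - (√3 : ℝ) * rho_sq
  rw [e, zeta_rho_mul, zeta_add_rho_mul hz', mul_add, ← zeta_rho_mul, ← mul_assoc,
    rho_mul_rho', one_mul, ← mul_assoc, ← pow_two, rho'_sq]

lemma conj_η₁ : (starRingEnd ℂ) η₁ = η₁ := by
  have e : hexPair.ω₁ / 2 = ((√3 / 2 : ℝ) : ℂ) := by rw [hexPair_ω₁]; push_cast; rfl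
  rw [η₁, map_mul, ← zeta_conj, e, conj_ofReal, conj_ofNat]

/-! ### The zeta function on the imaginary axis -/

/-- `i ζ(i s) - η₁ s / √3`. -/
noncomputable def axisZeta (s : ℝ) : ℂ := I * zeta hexPair (I * s) - η₁ * s / (√3 : ℝ)

lemma sqrt_three_cast_ne_zero : ((√3 : ℝ) : ℂ) ≠ 0 := by
  exact_mod_cast sqrt_three_pos.ne'

/-- Rotation by `ρ` fixes `i` modulo the lattice, since `ρ i = i + ρ' √3`. Combining equivariance
with the quasi-period therefore determines `ζ(i)`. -/
lemma axisZeta_one : axisZeta 1 = 0 := by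
  have h3 := sqrt_three_sq
  have h0 := sqrt_three_cast_ne_zero
  have hI : I ∉ Λ := notMem_of_im (by simp) (by norm_num)
  have h1 := zeta_add_rho'_mul hI
  have e1 : I + ρ' * (√3 : ℝ) = ρ * I := by
    apply Complex.ext <;> simp <;> linarith
  have e2 : ρ * (√3 : ℝ) = -I * (ρ' - 1) := by
    apply Complex.ext <;> simp <;> linarith
  rw [e1, zeta_rho_mul] at h1
  have hr : ρ' - 1 ≠ 0 := fun h => by
    have := congrArg re h
    simp at this
    norm_num at this
  have h2 : zeta hexPair I * (√3 : ℝ) = -I * η₁ := by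
    apply mul_left_cancel₀ hr
    linear_combination (√3 : ℝ) * h1 + η₁ * e2
  rw [axisZeta, ofReal_one, mul_one, mul_one, sub_eq_zero, eq_div_iff h0]
  linear_combination I * h2 - η₁ * I_mul_I

/-- The point `3i/2` is a half-period, `3i = (ρ - ρ') √3`, so `2 ζ(3i/2)` is the corresponding
quasi-period. -/
lemma axisZeta_three_div_two : axisZeta (3 / 2) = 0 := by
  have h3 := sqrt_three_sq
  have h0 := sqrt_three_cast_ne_zero
  have hI : -(I * (3 / 2 : ℝ)) ∉ Λ := by
    rw [neg_mem_iff]; exact I_mul_notMem (by norm_num) (by norm_num)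
  have hI' : -(I * (3 / 2 : ℝ)) - ρ' * (√3 : ℝ) ∉ Λ := fun h => hI (by
    have := add_mem h (rho'_mul_mem (hexPair_ω₁ ▸ hexPair.ω₁_mem_lattice))
    rwa [sub_add_cancel] at this)
  have h1 := zeta_add_rho_mul hI'
  have h2 := zeta_add_rho'_mul hI'
  have e1 : -(I * (3 / 2 : ℝ)) - ρ' * (√3 : ℝ) + ρ * (√3 : ℝ) = I * (3 / 2 : ℝ) := by
    apply Complex.ext <;> simp; linarith
  rw [sub_add_cancel, zeta_neg] at h2
  rw [e1] at h1
  have h4 : 2 * zeta hexPair (I * (3 / 2 : ℝ)) = (ρ' - ρ) * η₁ := by linear_combination h1 - h2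
  rw [rho'_sub_rho] at h4
  have h3' : ((√3 : ℝ) : ℂ) * (√3 : ℝ) = 3 := by exact_mod_cast h3
  rw [axisZeta, sub_eq_zero, eq_div_iff h0]
  push_cast at *
  linear_combination I * (√3 : ℝ) / 2 * h4 - η₁ * (√3 : ℝ) ^ 2 / 2 * I_mul_I + η₁ / 2 * h3'

lemma weierstrassP_I_mul_re (s : ℝ) : ((℘[hexPair] (I * s)).re : ℂ) = ℘[hexPair] (I * s) := by
  rw [← conj_eq_iff_re, ← weierstrassP_conj, map_mul, conj_I, conj_ofReal, neg_mul,
    PeriodPair.weierstrassP_neg]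

lemma hasDerivAt_axisZeta_re {s : ℝ} (h0 : 0 < s) (h1 : s < 3) :
    HasDerivAt (fun s => (axisZeta s).re) ((℘[hexPair] (I * s)).re - (η₁ / (√3 : ℝ)).re) s := by
  have hd := hasDerivAt_zeta hexPair (I_mul_notMem h0 h1)
  have h2 : HasDerivAt (fun z : ℂ => I * zeta hexPair (I * z) - η₁ * z / (√3 : ℝ))
      (℘[hexPair] (I * s) - η₁ / (√3 : ℝ)) (s : ℂ) := by
    have h3 := (hd.comp (s : ℂ) ((hasDerivAt_id (s : ℂ)).const_mul I)).const_mul I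
    have h4 := h3.fun_sub (((hasDerivAt_id (s : ℂ)).const_mul η₁).div_const (√3 : ℝ))
    refine h4.congr_deriv ?_
    linear_combination -(℘[hexPair] (I * s)) * I_mul_I
  exact h2.real_of_complex

/-- Equality of values forces `i (s ± t) ∈ Λ`, while the lattice points on the imaginary axis are
the multiples of `3i`. -/
lemma injOn_weierstrassP_I_mul :
    Set.InjOn (fun s : ℝ => (℘[hexPair] (I * s)).re) (Set.Ioc 0 (3 / 2)) := by
  intro s hs t ht h
  have h' : ℘[hexPair] (I * s) = ℘[hexPair] (I * t) := by
    rw [← weierstrassP_I_mul_re, ← weierstrassP_I_mul_re t]; exact congrArg _ h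
  rw [weierstrassP_eq_iff hexPair (I_mul_notMem hs.1 (by linarith [hs.2]))
    (I_mul_notMem ht.1 (by linarith [ht.2])), ← mul_add, ← mul_sub, ← ofReal_add,
    ← ofReal_sub] at h'
  by_contra hne
  rcases h' with h' | h'
  · refine I_mul_notMem (by linarith [hs.1, ht.1]) ?_ h'
    rcases lt_or_gt_of_ne hne with hlt | hlt <;> linarith [hs.2, ht.2]
  · rcases lt_or_gt_of_ne hne with hlt | hlt
    · rw [← neg_mem_iff, ← mul_neg, ← ofReal_neg] at h'
      exact I_mul_notMem (by linarith) (by linarith [hs.1, ht.2]) h'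
    · exact I_mul_notMem (by linarith) (by linarith [ht.1, hs.2]) h'

lemma sign_of_strictConvexOn {f : ℝ → ℝ} (hf : StrictConvexOn ℝ (Set.Ioc 0 (3 / 2)) f)
    (h1 : f 1 = 0) (h2 : f (3 / 2) = 0) :
    (∀ s, 0 < s → s < 1 → 0 < f s) ∧ ∀ s, 1 < s → s < 3 / 2 → f s < 0 := by
  constructor
  · intro s hs0 hs1
    have h : (0 : ℝ) < 3 / 2 - s := by linarith
    have ha : 0 < 1 / 2 / (3 / 2 - s) := by positivity
    have hb : 0 < (1 - s) / (3 / 2 - s) := div_pos (by linarith) h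
    have m1 : s ∈ Set.Ioc (0 : ℝ) (3 / 2) := ⟨hs0, by linarith⟩
    have m2 : (3 / 2 : ℝ) ∈ Set.Ioc (0 : ℝ) (3 / 2) := ⟨by norm_num, le_rfl⟩
    have := hf.2 m1 m2 (by linarith) ha hb
      (by rw [← add_div, div_eq_one_iff_eq h.ne']; ring)
    rw [show (1 / 2 / (3 / 2 - s)) • s + ((1 - s) / (3 / 2 - s)) • (3 / 2 : ℝ) = 1 by
      rw [smul_eq_mul, smul_eq_mul, div_mul_eq_mul_div (1 / 2 : ℝ),
        div_mul_eq_mul_div (1 - s), ← add_div,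
        div_eq_one_iff_eq h.ne']
      ring, h1, h2, smul_zero, add_zero, smul_eq_mul] at this
    exact (mul_pos_iff_of_pos_left ha).mp this
  · intro s hs0 hs1
    have m1 : (1 : ℝ) ∈ Set.Ioc (0 : ℝ) (3 / 2) := ⟨by norm_num, by norm_num⟩
    have m2 : (3 / 2 : ℝ) ∈ Set.Ioc (0 : ℝ) (3 / 2) := ⟨by norm_num, le_rfl⟩
    have ha : 0 < 3 - 2 * s := by linarith
    have hb : 0 < 2 * s - 2 := by linarith
    have := hf.2 m1 m2 (by norm_num) ha hb (by ring)
    rw [h1, h2] at this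
    simp only [smul_eq_mul, mul_zero, add_zero] at this
    rwa [show (3 - 2 * s) * 1 + (2 * s - 2) * (3 / 2) = s by ring] at this

/-- The function `i ζ(i s) - η₁ s / √3` has opposite signs on `(0, 1)` and `(1, 3/2)`. -/
lemma axisZeta_sign :
    ((∀ s, 0 < s → s < 1 → 0 < (axisZeta s).re) ∧
      ∀ s, 1 < s → s < 3 / 2 → (axisZeta s).re < 0) ∨
    ((∀ s, 0 < s → s < 1 → (axisZeta s).re < 0) ∧
      ∀ s, 1 < s → s < 3 / 2 → 0 < (axisZeta s).re) := by
  have h1 : (axisZeta 1).re = 0 := by rw [axisZeta_one, zero_re]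
  have h2 : (axisZeta (3 / 2)).re = 0 := by rw [axisZeta_three_div_two, zero_re]
  have hc : ContinuousOn (fun s => (axisZeta s).re) (Set.Ioc 0 (3 / 2)) := fun s hs =>
    (hasDerivAt_axisZeta_re hs.1 (by linarith [hs.2])).continuousAt.continuousWithinAt
  have hp : ContinuousOn (fun s : ℝ => (℘[hexPair] (I * s)).re) (Set.Ioo 0 (3 / 2)) := by
    intro s hs
    have hm := (hasDerivAt_weierstrassP hexPair
      (I_mul_notMem hs.1 (by linarith [hs.2]))).continuousAt
    have : ContinuousAt (fun s : ℝ => I * (s : ℂ)) s := by fun_prop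
    exact (continuous_re.continuousAt.comp
      (ContinuousAt.comp (f := fun s : ℝ => I * (s : ℂ)) hm this)).continuousWithinAt
  have hderiv : ∀ s ∈ Set.Ioo (0 : ℝ) (3 / 2), deriv (fun s => (axisZeta s).re) s =
      (℘[hexPair] (I * s)).re - (η₁ / (√3 : ℝ)).re := fun s hs =>
    (hasDerivAt_axisZeta_re hs.1 (by linarith [hs.2])).deriv
  -- The direction of monotonicity is left undecided: only the relative sign of `axisZeta` on the
  -- two intervals is used later.
  rcases hp.strictMonoOn_of_injOn_Ioo (by norm_num)
    (injOn_weierstrassP_I_mul.mono Set.Ioo_subset_Ioc_self) with hm | hm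
  · left
    refine sign_of_strictConvexOn
      (StrictMonoOn.strictConvexOn_of_deriv (convex_Ioc _ _) hc ?_) h1 h2
    rw [interior_Ioc]
    intro s hs t ht hst
    rw [hderiv s hs, hderiv t ht]
    exact sub_lt_sub_right (hm hs ht hst) _
  · right
    have := sign_of_strictConvexOn (StrictAntiOn.strictConcaveOn_of_deriv (convex_Ioc _ _)
      hc (by
        rw [interior_Ioc]
        intro s hs t ht hst
        rw [hderiv s hs, hderiv t ht]
        exact sub_lt_sub_right (hm hs ht hst) _)).neg (by simp [h1]) (by simp [h2])
    simpa using this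

/-! ### The derivative along the real axis -/

/-- The derivative of the abelian integral whose real part is `g`, centred at `-α / 2`, where
`s = √3 α / 2`. -/
noncomputable def gradFun (s : ℝ) (w : ℂ) : ℂ :=
  zeta hexPair (w + I * s) - zeta hexPair (w - I * s) + I * η₁ * (2 * s / (√3 : ℝ))

lemma gradFun_neg (s : ℝ) (w : ℂ) : gradFun s (-w) = gradFun s w := by
  rw [gradFun, gradFun, show -w + I * s = -(w - I * s) by ring,
    show -w - I * s = -(w + I * s) by ring, zeta_neg, zeta_neg]
  ring

lemma gradFun_re {s : ℝ} (w : ℝ) : ((I * gradFun s w).re : ℂ) = I * gradFun s w := by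
  rw [← conj_eq_iff_re, gradFun]
  simp only [map_mul, map_add, map_sub, map_div₀, ← zeta_conj, conj_I, conj_ofReal, conj_η₁,
    conj_ofNat]
  rw [neg_mul I (s : ℂ), ← sub_eq_add_neg, sub_neg_eq_add]
  ring

lemma gradFun_eq_zero_iff {s w : ℝ} : gradFun s w = 0 ↔ (I * gradFun s w).re = 0 := by
  rw [← ofReal_eq_zero, gradFun_re, mul_eq_zero, or_iff_right I_ne_zero]

lemma gradFun_add_sqrt_three {s : ℝ} (h0 : 0 < s) (h1 : s < 3 / 2) (w : ℝ) :
    gradFun s ((w + √3 : ℝ) : ℂ) = gradFun s w := by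
  obtain ⟨m1, m2⟩ := add_I_mul_notMem h0 h1 w
  rw [gradFun, gradFun, ofReal_add, add_right_comm, zeta_add_sqrt_three m1,
    add_sub_right_comm (w : ℂ), zeta_add_sqrt_three m2]
  ring

lemma gradFun_add_zsmul {s : ℝ} (h0 : 0 < s) (h1 : s < 3 / 2) (w : ℝ) (n : ℤ) :
    gradFun s ((w + n • √3 : ℝ) : ℂ) = gradFun s w := by
  have : Function.Periodic (fun w : ℝ => gradFun s w) (√3) := gradFun_add_sqrt_three h0 h1
  exact this.zsmul n w

lemma gradFun_zero (s : ℝ) : I * gradFun s 0 = 2 * axisZeta s := by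
  rw [gradFun, axisZeta, zero_add, zero_sub, zeta_neg]
  linear_combination η₁ * (2 * s / (√3 : ℝ)) * I_mul_I

/-- Shifting `√3/2 ± is` by the periods `ρ'√3` and `ρ√3` respectively lands on `∓i (3/2 - s)`, so
the value is again one on the imaginary axis. -/
lemma gradFun_half {s : ℝ} (h0 : 0 < s) (h1 : s < 3 / 2) :
    I * gradFun s ((√3 / 2 : ℝ) : ℂ) = -2 * axisZeta (3 / 2 - s) := by
  have h3 := sqrt_three_sq
  have hne := sqrt_three_cast_ne_zero
  have h3' : ((√3 : ℝ) : ℂ) * (√3 : ℝ) = 3 := by exact_mod_cast h3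
  have hr := one_add_rho_add_rho'
  obtain ⟨m1, m2⟩ := add_I_mul_notMem h0 h1 (√3 / 2)
  have e1 : ((√3 / 2 : ℝ) : ℂ) + I * s + ρ' * (√3 : ℝ) = -(I * (3 / 2 - s : ℝ)) := by
    apply Complex.ext <;> simp <;> linarith
  have e2 : ((√3 / 2 : ℝ) : ℂ) - I * s + ρ * (√3 : ℝ) = I * (3 / 2 - s : ℝ) := by
    apply Complex.ext <;> simp <;> linarith
  have q1 := zeta_add_rho'_mul m1
  have q2 := zeta_add_rho_mul m2
  rw [e1, zeta_neg] at q1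
  rw [e2] at q2
  have e3 := rho'_sub_rho
  have e4 : ((3 / 2 - s : ℝ) : ℂ) / (√3 : ℝ) = (√3 : ℝ) / 2 - s / (√3 : ℝ) := by
    rw [div_eq_iff hne, sub_mul, div_mul_cancel₀ _ hne]
    push_cast
    linear_combination -h3' / 2
  rw [gradFun, axisZeta, mul_div_assoc η₁, e4]
  linear_combination (-I) * q1 + I * q2 + I * η₁ * e3 + η₁ * (2 * s / (√3 : ℝ) - (√3 : ℝ)) * I_mul_I

/-! ### Zeros of the derivative on the real axis -/

lemma gradFun_eq {s w : ℝ} (h0 : 0 < s) (h1 : s < 3 / 2) (hw : (w : ℂ) ∉ Λ) :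
    gradFun s w = gradFun s 0 - hexPair.derivWeierstrassP (I * s) /
      (℘[hexPair] w - ℘[hexPair] (I * s)) := by
  obtain ⟨m1, m2⟩ := add_I_mul_notMem h0 h1 w
  rw [gradFun, zeta_add_sub_zeta_sub hexPair hw (I_mul_notMem h0 (by linarith)) m1 m2, gradFun,
    zero_add, zero_sub, zeta_neg]
  ring

lemma weierstrassP_ne {s w : ℝ} (h0 : 0 < s) (h1 : s < 3 / 2) (hw : (w : ℂ) ∉ Λ) :
    ℘[hexPair] w - ℘[hexPair] (I * s) ≠ 0 := by
  obtain ⟨m1, m2⟩ := add_I_mul_notMem h0 h1 w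
  rw [sub_ne_zero, ne_eq, weierstrassP_eq_iff hexPair hw (I_mul_notMem h0 (by linarith))]
  tauto

lemma derivWeierstrassP_I_mul_ne_zero {s : ℝ} (h0 : 0 < s) (h1 : s < 3 / 2) :
    hexPair.derivWeierstrassP (I * s) ≠ 0 := by
  rw [ne_eq, derivWeierstrassP_eq_zero_iff hexPair (I_mul_notMem h0 (by linarith)),
    show 2 * (I * s) = I * (2 * s : ℝ) by push_cast; ring]
  exact I_mul_notMem (by linarith) (by linarith)

lemma injOn_gradFun {s : ℝ} (h0 : 0 < s) (h1 : s < 3 / 2) :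
    Set.InjOn (fun w : ℝ => (I * gradFun s w).re) (Set.Icc 0 (√3 / 2)) := by
  have hs := sqrt_three_pos
  have hp := derivWeierstrassP_I_mul_ne_zero h0 h1
  -- The point `w = 0` is treated apart: `℘` has its pole there, and `gradFun_eq` does not apply.
  have key0 : ∀ w : ℝ, 0 < w → w ≤ √3 / 2 → gradFun s w ≠ gradFun s (0 : ℝ) := by
    intro w hw0 hw1 h
    have hw := ofReal_notMem hw0 (by linarith)
    rw [gradFun_eq h0 h1 hw, ofReal_zero, sub_eq_self, div_eq_zero_iff] at h
    exact h.elim hp (weierstrassP_ne h0 h1 hw)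
  have key : ∀ w v : ℝ, 0 < w → w ≤ √3 / 2 → 0 < v → v ≤ √3 / 2 → gradFun s w = gradFun s v →
      w ≤ v := by
    intro w v hw0 hw1 hv0 hv1 h
    have hw := ofReal_notMem hw0 (by linarith)
    have hv := ofReal_notMem hv0 (by linarith)
    rw [gradFun_eq h0 h1 hw, gradFun_eq h0 h1 hv, sub_right_inj,
      div_eq_div_iff (weierstrassP_ne h0 h1 hw) (weierstrassP_ne h0 h1 hv)] at h
    have h2 := mul_left_cancel₀ hp h
    rw [sub_left_inj, eq_comm, weierstrassP_eq_iff hexPair hw hv, ← ofReal_add, ← ofReal_sub] at h2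
    by_contra! hlt
    rcases h2 with h2 | h2
    · exact ofReal_notMem (by linarith) (by linarith) h2
    · exact ofReal_notMem (by linarith) (by linarith) h2
  intro w hw v hv h
  have h' : gradFun s w = gradFun s v := by
    apply mul_left_cancel₀ I_ne_zero
    rw [← gradFun_re w, ← gradFun_re v]
    exact congrArg ((↑) : ℝ → ℂ) h
  rcases hw.1.eq_or_lt with rfl | hw0 <;> rcases hv.1.eq_or_lt with rfl | hv0
  · rfl
  · exact absurd h'.symm (key0 v hv0 hv.2)
  · exact absurd h' (key0 w hw0 hw.2)
  · exact le_antisymm (key w v hw0 hw.2 hv0 hv.2 h') (key v w hv0 hv.2 hw0 hw.2 h'.symm)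

lemma hasDerivAt_gradFun {s : ℝ} {w : ℂ} (h1 : w + I * s ∉ Λ) (h2 : w - I * s ∉ Λ) :
    HasDerivAt (gradFun s) (-℘[hexPair] (w + I * s) + ℘[hexPair] (w - I * s)) w := by
  have := (((hasDerivAt_zeta hexPair h1).comp_add_const w (I * s)).fun_sub
    ((hasDerivAt_zeta hexPair h2).comp_sub_const w (I * s))).add_const
      (I * η₁ * (2 * s / (√3 : ℝ)))
  exact this.congr_deriv (by ring)

lemma continuous_gradFun {s : ℝ} (h0 : 0 < s) (h1 : s < 3 / 2) :
    Continuous fun w : ℝ => (I * gradFun s w).re := by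
  rw [continuous_iff_continuousAt]
  intro w
  obtain ⟨m1, m2⟩ := add_I_mul_notMem h0 h1 w
  have h := (hasDerivAt_gradFun m1 m2).continuousAt
  have : ContinuousAt (fun w : ℝ => gradFun s w) w :=
    ContinuousAt.comp (f := fun w : ℝ => (w : ℂ)) h continuous_ofReal.continuousAt
  exact continuous_re.continuousAt.comp (continuousAt_const.mul this)

lemma gradFun_zero_re (s : ℝ) : (I * gradFun s (0 : ℝ)).re = 2 * (axisZeta s).re := by
  rw [ofReal_zero, gradFun_zero]; simp

lemma gradFun_half_re {s : ℝ} (h0 : 0 < s) (h1 : s < 3 / 2) :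
    (I * gradFun s ((√3 / 2 : ℝ) : ℂ)).re = -2 * (axisZeta (3 / 2 - s)).re := by
  rw [gradFun_half h0 h1]; simp

/-- Up to sign and translation by a period, every real number lies in `[0, √3 / 2]`. -/
lemma exists_reduction (w : ℝ) : ∃ v ∈ Set.Icc 0 (√3 / 2), ∃ n : ℤ,
    w = v + n • √3 ∨ w = -v + n • √3 := by
  have hs := sqrt_three_pos
  have h := abs_sub_round (w / √3)
  refine ⟨|w - round (w / √3) * √3|, ⟨abs_nonneg _, ?_⟩, round (w / √3), ?_⟩
  · have : w - round (w / √3) * √3 = (w / √3 - round (w / √3)) * √3 := by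
      rw [sub_mul, div_mul_cancel₀ _ hs.ne']
    rw [this, abs_mul, abs_of_pos hs]
    nlinarith
  · rw [zsmul_eq_mul]
    rcases abs_choice (w - round (w / √3) * √3) with h | h <;> rw [h]
    · left; ring
    · right; ring

lemma gradFun_reduction {s : ℝ} (h0 : 0 < s) (h1 : s < 3 / 2) (v : ℝ) (n : ℤ) :
    gradFun s ((-v + n • √3 : ℝ) : ℂ) = gradFun s v := by
  rw [gradFun_add_zsmul h0 h1, ofReal_neg, gradFun_neg]

/-- Here `s < 1 < 3/2 - s`, so the end values `2A(s)` and `-2A(3/2 - s)` have the same sign and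
monotonicity leaves no zero between them. -/
lemma gradFun_ne_zero {s : ℝ} (h0 : 0 < s) (h1 : s < 1 / 2) (w : ℝ) : gradFun s w ≠ 0 := by
  have hs := sqrt_three_pos
  have h1' : s < 3 / 2 := by linarith
  have key : ∀ v ∈ Set.Icc 0 (√3 / 2), gradFun s (v : ℝ) ≠ 0 := by
    intro v hv h
    rw [gradFun_eq_zero_iff] at h
    have hm := (continuous_gradFun h0 h1').continuousOn.strictMonoOn_of_injOn_Icc'
      (by positivity) (injOn_gradFun h0 h1')
    have l : (0 : ℝ) ∈ Set.Icc 0 (√3 / 2) := ⟨le_rfl, by positivity⟩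
    have r : √3 / 2 ∈ Set.Icc 0 (√3 / 2) := ⟨by positivity, le_rfl⟩
    have e0 := gradFun_zero_re s
    have e1 := gradFun_half_re h0 h1'
    rcases axisZeta_sign with ⟨hp, hn⟩ | ⟨hn, hp⟩
    · have i1 := hp s h0 (by linarith)
      have i2 := hn (3 / 2 - s) (by linarith) (by linarith)
      rcases hm with hm | hm
      · have := hm.monotoneOn l hv hv.1
        linarith
      · have := hm.antitoneOn hv r hv.2
        linarith
    · have i1 := hn s h0 (by linarith)
      have i2 := hp (3 / 2 - s) (by linarith) (by linarith)
      rcases hm with hm | hm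
      · have := hm.monotoneOn hv r hv.2
        linarith
      · have := hm.antitoneOn l hv hv.1
        linarith
  obtain ⟨v, hv, n, rfl | rfl⟩ := exists_reduction w
  · rw [gradFun_add_zsmul h0 h1']; exact key v hv
  · rw [gradFun_reduction h0 h1']; exact key v hv

lemma gradFun_half_eq_zero_iff {w : ℝ} :
    gradFun (1 / 2 : ℝ) w = 0 ↔ ∃ n : ℤ, w = √3 / 2 + n • √3 := by
  have hs := sqrt_three_pos
  have h0 : (0 : ℝ) < 1 / 2 := by norm_num
  have h1 : (1 / 2 : ℝ) < 3 / 2 := by norm_num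
  have e1 : gradFun (1 / 2 : ℝ) ((√3 / 2 : ℝ) : ℂ) = 0 := by
    rw [gradFun_eq_zero_iff, gradFun_half_re h0 h1, show (3 / 2 - 1 / 2 : ℝ) = 1 by norm_num,
      axisZeta_one]
    simp
  have key : ∀ v ∈ Set.Icc 0 (√3 / 2), gradFun (1 / 2 : ℝ) (v : ℝ) = 0 → v = √3 / 2 := by
    intro v hv h
    refine injOn_gradFun h0 h1 hv ⟨by positivity, le_rfl⟩ ?_
    simp only [h, e1]
  constructor
  · intro h
    obtain ⟨v, hv, n, rfl | rfl⟩ := exists_reduction w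
    · rw [gradFun_add_zsmul h0 h1] at h
      exact ⟨n, by rw [← key v hv h]⟩
    · rw [gradFun_reduction h0 h1] at h
      refine ⟨n - 1, ?_⟩
      rw [key v hv h, sub_smul, one_smul]
      ring
  · rintro ⟨n, rfl⟩
    rw [gradFun_add_zsmul h0 h1, e1]

/-- Now `s` and `3/2 - s` both lie in `(0, 1)`, so the end values have opposite signs and there is
exactly one zero in between; evenness and periodicity produce the others. -/
lemma exists_gradFun_eq_zero_iff {s : ℝ} (h0 : 1 / 2 < s) (h1 : s < 3 / 4) :
    ∃ v : ℝ, 0 < v ∧ v < √3 / 2 ∧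
      ∀ w : ℝ, gradFun s w = 0 ↔ ∃ n : ℤ, w = v + n • √3 ∨ w = -v + n • √3 := by
  have hs := sqrt_three_pos
  have h0' : 0 < s := by linarith
  have h1' : s < 3 / 2 := by linarith
  have hc := (continuous_gradFun h0' h1').continuousOn (s := Set.Icc 0 (√3 / 2))
  have e0 := gradFun_zero_re s
  have e1 := gradFun_half_re h0' h1'
  obtain ⟨v, hv, hv0⟩ : ∃ v ∈ Set.Ioo 0 (√3 / 2), (I * gradFun s (v : ℝ)).re = 0 := by
    rcases axisZeta_sign with ⟨hp, -⟩ | ⟨hn, -⟩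
    · have i1 := hp s h0' (by linarith)
      have i2 := hp (3 / 2 - s) (by linarith) (by linarith)
      exact intermediate_value_Ioo' (by positivity) hc
        ⟨by linarith, by linarith⟩
    · have i1 := hn s h0' (by linarith)
      have i2 := hn (3 / 2 - s) (by linarith) (by linarith)
      exact intermediate_value_Ioo (by positivity) hc
        ⟨by linarith, by linarith⟩
  have hz := gradFun_eq_zero_iff.mpr hv0
  refine ⟨v, hv.1, hv.2, fun w => ⟨fun h => ?_, ?_⟩⟩
  · obtain ⟨x, hx, n, hn⟩ := exists_reduction w
    have : gradFun s (x : ℝ) = 0 := by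
      rcases hn with rfl | rfl
      · rwa [gradFun_add_zsmul h0' h1'] at h
      · rwa [gradFun_reduction h0' h1'] at h
    rw [gradFun_eq_zero_iff] at this
    have hxv : x = v := injOn_gradFun h0' h1' hx ⟨hv.1.le, hv.2.le⟩ (this.trans hv0.symm)
    exact ⟨n, hxv ▸ hn⟩
  · rintro ⟨n, rfl | rfl⟩
    · rwa [gradFun_add_zsmul h0' h1']
    · rwa [gradFun_reduction h0' h1']

/-! ### Critical points of `g` -/

/-- The real-linear map `v ↦ Re (a v)`. -/
noncomputable def reMul (a : ℂ) : ℂ →L[ℝ] ℝ := reCLM ∘L ContinuousLinearMap.mul ℝ ℂ a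

@[simp] lemma reMul_apply (a v : ℂ) : reMul a v = (a * v).re := rfl

lemma reMul_eq_zero_iff {a : ℂ} : reMul a = 0 ↔ a = 0 := by
  refine ⟨fun h => ?_, ?_⟩
  · have h1 := DFunLike.congr_fun h 1
    have h2 := DFunLike.congr_fun h I
    simp at h1 h2
    exact Complex.ext h1 h2
  · rintro rfl
    ext v; simp

lemma HasDerivAt.hasFDerivAt_re {f : ℂ → ℂ} {a z : ℂ} (h : HasDerivAt f a z) :
    HasFDerivAt (fun z => (f z).re) (reMul a) z := by
  have h1 := reCLM.hasFDerivAt.comp z (h.hasFDerivAt.restrictScalars ℝ)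
  refine h1.congr_fderiv ?_
  ext v
  simp [mul_comm]

lemma hasFDerivAt_log_norm {f : ℂ → ℂ} {a z : ℂ} (h : HasDerivAt f a z) (hz : f z ≠ 0) :
    HasFDerivAt (fun z => Real.log ‖f z‖) (reMul (a / f z)) z := by
  -- Normalizing by `f z` puts the argument of the logarithm near `1`, away from the branch cut.
  have h1 : HasDerivAt (fun w => Complex.log (f w / f z)) (a / f z) z := by
    have := (h.div_const (f z)).clog (by rw [div_self hz]; exact one_mem_slitPlane)
    refine this.congr_deriv ?_
    rw [div_self hz, div_one]
  have h2 := (HasDerivAt.hasFDerivAt_re h1).add_const (Real.log ‖f z‖)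
  refine h2.congr_of_eventuallyEq ?_
  filter_upwards [h.continuousAt.eventually_ne hz] with w hw
  rw [log_re, norm_div, Real.log_div (norm_ne_zero_iff.mpr hw) (norm_ne_zero_iff.mpr hz)]
  ring

lemma rho_mul_ofReal (α : ℝ) : ρ * α = -(α / 2 : ℝ) + I * (√3 / 2 * α : ℝ) := by
  apply Complex.ext
  · simp; ring
  · simp

lemma rho'_mul_ofReal (α : ℝ) : ρ' * α = -(α / 2 : ℝ) - I * (√3 / 2 * α : ℝ) := by
  apply Complex.ext
  · simp; ring
  · simp

lemma hasFDerivAt_g (α : ℝ) {z : ℂ} (h1 : z + (α / 2 : ℝ) + I * (√3 / 2 * α : ℝ) ∉ Λ)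
    (h2 : z + (α / 2 : ℝ) - I * (√3 / 2 * α : ℝ) ∉ Λ) :
    HasFDerivAt (g α) (reMul (gradFun (√3 / 2 * α) (z + (α / 2 : ℝ)))) z := by
  have h3' : ((√3 : ℝ) : ℂ) * (√3 : ℝ) = 3 := by exact_mod_cast sqrt_three_sq
  have hne := sqrt_three_cast_ne_zero
  have e1 : z - ρ' * α = z + (α / 2 : ℝ) + I * (√3 / 2 * α : ℝ) := by
    rw [rho'_mul_ofReal]; ring
  have e2 : z - ρ * α = z + (α / 2 : ℝ) - I * (√3 / 2 * α : ℝ) := by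
    rw [rho_mul_ofReal]; ring
  rw [← e1] at h1
  rw [← e2] at h2
  have n1 := sigma_ne_zero hexPair h1
  have n2 := sigma_ne_zero hexPair h2
  have d1 := hasFDerivAt_log_norm ((hasDerivAt_sigma hexPair h1).comp_sub_const z (ρ' * α)) n1
  have d2 := hasFDerivAt_log_norm ((hasDerivAt_sigma hexPair h2).comp_sub_const z (ρ * α)) n2
  have d3 := HasDerivAt.hasFDerivAt_re ((hasDerivAt_id z).const_mul
    (((√3 / 3 : ℝ) : ℂ) * η₁ * (starRingEnd ℂ) α * (ρ' - ρ)))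
  have d4 := (d1.sub d2).sub d3
  have hg : g α = ((fun z => Real.log ‖sigma hexPair (z - ρ' * α)‖) -
      (fun z => Real.log ‖sigma hexPair (z - ρ * α)‖)) -
      fun z => (((√3 / 3 : ℝ) : ℂ) * η₁ * (starRingEnd ℂ) α * (ρ' - ρ) * id z).re := rfl
  rw [hg]
  refine d4.congr_fderiv ?_
  have e3 : sigma hexPair (z - ρ' * α) * zeta hexPair (z - ρ' * α) / sigma hexPair (z - ρ' * α) -
      sigma hexPair (z - ρ * α) * zeta hexPair (z - ρ * α) / sigma hexPair (z - ρ * α) -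
      ((√3 / 3 : ℝ) : ℂ) * η₁ * (starRingEnd ℂ) α * (ρ' - ρ) * 1 =
      gradFun (√3 / 2 * α) (z + (α / 2 : ℝ)) := by
    rw [mul_div_cancel_left₀ _ n1, mul_div_cancel_left₀ _ n2, gradFun, ← e1, ← e2, rho'_sub_rho,
      conj_ofReal]
    have : (2 * ((√3 / 2 * α : ℝ) : ℂ)) / (√3 : ℝ) = α := by
      rw [div_eq_iff hne]; push_cast; ring
    rw [this]
    push_cast
    linear_combination I * η₁ * α / 3 * h3'
  rw [← e3]
  ext v
  simp only [FunLike.coe_sub, Pi.sub_apply, reMul_apply, sub_mul, sub_re]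

lemma mul_mem_Ioo_of_lt {α : ℝ} (h0 : 0 < α) (h1 : α < √3 / 2) :
    0 < √3 / 2 * α ∧ √3 / 2 * α < 3 / 4 := by
  have hs := sqrt_three_pos
  have h3 := sqrt_three_sq
  exact ⟨by positivity, by nlinarith⟩

lemma isCriticalPoint_iff {α : ℝ} (h0 : 0 < α) (h1 : α < √3 / 2) (x : ℝ) :
    IsCriticalPoint (g α) x ↔ gradFun (√3 / 2 * α) ((x + α / 2 : ℝ) : ℂ) = 0 := by
  obtain ⟨i0, i1⟩ := mul_mem_Ioo_of_lt h0 h1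
  obtain ⟨m1, m2⟩ := add_I_mul_notMem i0 (by linarith) (x + α / 2)
  rw [ofReal_add] at m1 m2 ⊢
  have h := hasFDerivAt_g α m1 m2
  rw [← reMul_eq_zero_iff, IsCriticalPoint]
  exact ⟨fun h' => h.unique h', fun h' => h' ▸ h⟩

lemma encard_criticalPoints {α : ℝ} (h0 : √3 / 3 < α) (h1 : α < √3 / 2) (x₀ : ℝ) :
    {x : ℝ | x ∈ Set.Ico x₀ (x₀ + √3) ∧ IsCriticalPoint (g α) x}.encard = 2 := by
  have hs := sqrt_three_pos
  have h3 := sqrt_three_sq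
  have h0' : 0 < α := (by positivity : 0 < √3 / 3).trans h0
  obtain ⟨i0, i1⟩ := mul_mem_Ioo_of_lt h0' h1
  obtain ⟨v, hv0, hv1, hv⟩ := exists_gradFun_eq_zero_iff (s := √3 / 2 * α) (by nlinarith) i1
  obtain ⟨m, hm, hm'⟩ := existsUnique_add_zsmul_mem_Ico hs (v - α / 2) x₀
  obtain ⟨n, hn, hn'⟩ := existsUnique_add_zsmul_mem_Ico hs (-v - α / 2) x₀
  rw [Set.encard_eq_two]
  refine ⟨v - α / 2 + m • √3, -v - α / 2 + n • √3, fun h => ?_, ?_⟩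
  -- Since `0 < 2v < √3`, the points `v` and `-v` are distinct modulo `√3`.
  · simp only [zsmul_eq_mul] at h
    have hk : 2 * v = ((n - m : ℤ) : ℝ) * √3 := by push_cast; linarith
    have k0 : (0 : ℝ) < ((n - m : ℤ) : ℝ) := by
      by_contra! hk'
      nlinarith
    have k1 : ((n - m : ℤ) : ℝ) < 1 := by
      by_contra! hk'
      nlinarith
    have : 0 < n - m := by exact_mod_cast k0
    have : n - m < 1 := by exact_mod_cast k1
    omega
  · ext x
    simp only [Set.mem_ofPred_eq, isCriticalPoint_iff h0' h1, hv, Set.mem_insert_iff,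
      Set.mem_singleton_iff]
    constructor
    · rintro ⟨hx, k, hk | hk⟩
      · left
        have e : x = v - α / 2 + k • √3 := by linarith
        rw [e] at hx ⊢
        rw [hm' k hx]
      · right
        have e : x = -v - α / 2 + k • √3 := by linarith
        rw [e] at hx ⊢
        rw [hn' k hx]
    · rintro (rfl | rfl)
      · exact ⟨hm, m, .inl (by ring)⟩
      · exact ⟨hn, n, .inr (by ring)⟩

lemma not_isCriticalPoint {α : ℝ} (h0 : 0 < α) (h1 : α < √3 / 3) (x : ℝ) :
    ¬ IsCriticalPoint (g α) x := by
  have hs := sqrt_three_pos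
  have h3 := sqrt_three_sq
  rw [isCriticalPoint_iff h0 (h1.trans z₁_lt)]
  exact gradFun_ne_zero (by positivity) (by nlinarith) _

lemma sqrt_three_mul_z₁ : √3 / 2 * (√3 / 3) = 1 / 2 := by
  linear_combination sqrt_three_sq / 6

lemma existsUnique_criticalPoint (x₀ : ℝ) :
    ∃! x : ℝ, x ∈ Set.Ico x₀ (x₀ + √3) ∧ IsCriticalPoint (g (√3 / 3 : ℝ)) x := by
  have hs := sqrt_three_pos
  obtain ⟨m, hm, hm'⟩ := existsUnique_add_zsmul_mem_Ico hs (√3 / 2 - √3 / 3 / 2) x₀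
  simp only [isCriticalPoint_iff (by positivity : 0 < √3 / 3) z₁_lt, sqrt_three_mul_z₁,
    gradFun_half_eq_zero_iff]
  refine ⟨√3 / 2 - √3 / 3 / 2 + m • √3, ⟨hm, m, by ring⟩, ?_⟩
  rintro x ⟨hx, n, hn⟩
  have e : x = √3 / 2 - √3 / 3 / 2 + n • √3 := by linarith
  rw [e] at hx ⊢
  rw [hm' n hx]

/-- The real zeros for `s = 1 / 2` are half-periods, hence zeros of order two. -/
lemma analyticOrderAt_gradFun {w : ℝ} (hw : gradFun (1 / 2 : ℝ) w = 0) :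
    analyticOrderAt (gradFun (1 / 2 : ℝ)) w = 2 := by
  have h0 : (0 : ℝ) < 1 / 2 := by norm_num
  have h1 : (1 / 2 : ℝ) < 3 / 2 := by norm_num
  have h2w : (w : ℂ) + w ∈ Λ := by
    obtain ⟨n, rfl⟩ := gradFun_half_eq_zero_iff.mp hw
    have := hexPair.lattice.smul_mem (1 + 2 * n) hexPair.ω₁_mem_lattice
    rw [hexPair_ω₁] at this
    convert this using 1
    simp only [zsmul_eq_mul]
    push_cast
    ring
  set a : ℂ := I * (1 / 2 : ℝ) with ha
  obtain ⟨m1, m2⟩ := add_I_mul_notMem h0 h1 w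
  rw [← ha] at m1 m2
  have hU : IsOpen {z : ℂ | z + a ∉ Λ ∧ z - a ∉ Λ} :=
    ((isOpen_compl_lattice hexPair).preimage (continuous_add_const a)).inter
      ((isOpen_compl_lattice hexPair).preimage (continuous_id.sub continuous_const))
  have hnhds := hU.mem_nhds (x := (w : ℂ)) ⟨m1, m2⟩
  have hdiff : DifferentiableOn ℂ (gradFun (1 / 2 : ℝ)) {z : ℂ | z + a ∉ Λ ∧ z - a ∉ Λ} :=
    fun z hz => (hasDerivAt_gradFun hz.1 hz.2).differentiableAt.differentiableWithinAt
  have han : AnalyticAt ℂ (gradFun (1 / 2 : ℝ)) w := hdiff.analyticAt hnhds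
  have hd1 : deriv (gradFun (1 / 2 : ℝ)) =ᶠ[𝓝 (w : ℂ)]
      fun z => -℘[hexPair] (z + a) + ℘[hexPair] (z - a) := by
    filter_upwards [hnhds] with z hz using (hasDerivAt_gradFun hz.1 hz.2).deriv
  have hd2 : HasDerivAt (fun z => -℘[hexPair] (z + a) + ℘[hexPair] (z - a))
      (-hexPair.derivWeierstrassP (w + a) + hexPair.derivWeierstrassP (w - a)) w :=
    ((hasDerivAt_weierstrassP hexPair m1).comp_add_const (w : ℂ) a).fun_neg.fun_add
      ((hasDerivAt_weierstrassP hexPair m2).comp_sub_const (w : ℂ) a)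
  -- The points `w + a` and `w - a` have sum `2w ∈ Λ`, so `℘` takes the same value at both.
  have hz1 : deriv (gradFun (1 / 2 : ℝ)) w = 0 := by
    rw [hd1.eq_of_nhds, neg_add_eq_zero, weierstrassP_eq_iff hexPair m1 m2]
    left
    simpa using h2w
  -- The second derivative is `-2 ℘'(w + a)`. It is nonzero because `2 (w + a)` has imaginary part
  -- `1`, while those of lattice points are multiples of `3/2`.
  have hz2 : deriv (deriv (gradFun (1 / 2 : ℝ))) w ≠ 0 := by
    have e : hexPair.derivWeierstrassP (w - a) = -hexPair.derivWeierstrassP (w + a) := by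
      have := hexPair.derivWeierstrassP_add_coe (-(w + a)) ⟨_, h2w⟩
      rw [hexPair.derivWeierstrassP_neg] at this
      rw [← this]
      congr 1
      simp only
      ring
    rw [hd1.deriv_eq, hd2.deriv, e, ← two_mul]
    refine mul_ne_zero two_ne_zero (neg_ne_zero.mpr ?_)
    rw [ne_eq, derivWeierstrassP_eq_zero_iff hexPair m1]
    exact notMem_of_im (by simp [ha]) (by simp [ha]; norm_num)
  rw [show (2 : ℕ∞) = ((1 : ℕ) : ℕ∞) + 1 by norm_num, analyticOrderAt_deriv_eq_iff han hw,
    show ((1 : ℕ) : ℕ∞) = ((0 : ℕ) : ℕ∞) + 1 by norm_num, analyticOrderAt_deriv_eq_iff han.deriv hz1]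
  exact han.deriv.deriv.analyticOrderAt_eq_zero.mpr hz2

lemma criticalMultiplicity_eq_two {x : ℝ} (hx : IsCriticalPoint (g (√3 / 3 : ℝ)) x) :
    criticalMultiplicity (g (√3 / 3 : ℝ)) x = 2 := by
  have h0 : (0 : ℝ) < 1 / 2 := by norm_num
  have h1 : (1 / 2 : ℝ) < 3 / 2 := by norm_num
  rw [isCriticalPoint_iff (by positivity) z₁_lt, sqrt_three_mul_z₁] at hx
  obtain ⟨m1, m2⟩ := add_I_mul_notMem h0 h1 (x + √3 / 3 / 2)
  have hc (b : ℂ) : Continuous fun z : ℂ => z + (√3 / 3 / 2 : ℝ) + b := by fun_prop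
  have hU : IsOpen {z : ℂ | z + (√3 / 3 / 2 : ℝ) + I * (1 / 2 : ℝ) ∉ Λ ∧
      z + (√3 / 3 / 2 : ℝ) + -(I * (1 / 2 : ℝ)) ∉ Λ} :=
    ((isOpen_compl_lattice hexPair).preimage (hc _)).inter
      ((isOpen_compl_lattice hexPair).preimage (hc _))
  rw [ofReal_add] at m1 m2
  rw [sub_eq_add_neg] at m2
  have heq : (fun w : ℂ => ((fderiv ℝ (g (√3 / 3 : ℝ)) w 1 : ℝ) : ℂ) -
      I * ((fderiv ℝ (g (√3 / 3 : ℝ)) w I : ℝ) : ℂ)) =ᶠ[𝓝 (x : ℂ)]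
      gradFun (1 / 2 : ℝ) ∘ fun w => w + (√3 / 3 / 2 : ℝ) := by
    filter_upwards [hU.mem_nhds (x := (x : ℂ)) ⟨m1, m2⟩] with w hw
    have h := hasFDerivAt_g (√3 / 3) (z := w)
    rw [sqrt_three_mul_z₁, sub_eq_add_neg] at h
    rw [(h hw.1 hw.2).fderiv]
    apply Complex.ext <;> simp
  rw [criticalMultiplicity, analyticOrderAt_congr heq,
    analyticOrderAt_comp_of_deriv_ne_zero (by fun_prop) (by simp), ← ofReal_add]
  exact analyticOrderAt_gradFun hx

end Nuttall

theorem mainTheorem8 :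
    -- the zeros of `g` are the points where `u (ρ z) = u (ρ' z)`
    (∀ (α : ℝ) (z : ℂ), 0 < α → α < √3 / 2 →
      Nuttall.g α z =
        (Nuttall.u α (Nuttall.ρ' * z) - Nuttall.u α (Nuttall.ρ * z)) / 3) ∧
    -- case 1
    ((∀ α : ℝ, 0 < α → α < √3 / 3 →
        ∀ x : ℝ, ¬ Nuttall.IsCriticalPoint (Nuttall.g α) x) ∧
      Nuttall.CorrespondsTo {α | 0 < α ∧ α < √3 / 3}
        (fun a₁ a₂ a₃ => dist a₁ a₂ = dist a₁ a₃ ∧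
          EuclideanGeometry.angle a₂ a₁ a₃ < Real.pi / 3)) ∧
    -- case 2
    ((∀ α : ℝ, √3 / 3 < α → α < √3 / 2 →
        ∀ x₀ : ℝ, {x : ℝ | x ∈ Set.Ico x₀ (x₀ + √3) ∧
          Nuttall.IsCriticalPoint (Nuttall.g α) x}.encard = 2) ∧
      Nuttall.CorrespondsTo {α | √3 / 3 < α ∧ α < √3 / 2}
        (fun a₁ a₂ a₃ => dist a₁ a₂ = dist a₁ a₃ ∧
          Real.pi / 3 < EuclideanGeometry.angle a₂ a₁ a₃)) ∧
    -- case 3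
    ((∀ α : ℝ, α = √3 / 3 →
        (∀ x₀ : ℝ, ∃! x : ℝ, x ∈ Set.Ico x₀ (x₀ + √3) ∧
          Nuttall.IsCriticalPoint (Nuttall.g α) x) ∧
        (∀ x : ℝ, Nuttall.IsCriticalPoint (Nuttall.g α) x →
          Nuttall.criticalMultiplicity (Nuttall.g α) x = 2)) ∧
      Nuttall.CorrespondsTo {α | α = √3 / 3}
        (fun a₁ a₂ a₃ => dist a₁ a₂ = dist a₁ a₃ ∧ dist a₁ a₂ = dist a₂ a₃)) :=
  ⟨fun α z _ _ => Nuttall.g_eq_u_sub_u α z,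
    ⟨fun _ h0 h1 x => Nuttall.not_isCriticalPoint h0 h1 x, Nuttall.correspondsTo_lt⟩,
    ⟨fun _ h0 h1 x₀ => Nuttall.encard_criticalPoints h0 h1 x₀, Nuttall.correspondsTo_gt⟩,
    ⟨by
      rintro α rfl
      exact ⟨Nuttall.existsUnique_criticalPoint,
        fun x hx => Nuttall.criticalMultiplicity_eq_two hx⟩, Nuttall.correspondsTo_eq⟩⟩
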